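/- Conventions. An oriented map is given by a set of darts with a rotation $R$ (the next dart around the initial vertex) and a fixed-point-free dart-reversing involution $L$; isomorphisms are bijections of the darts that commute with $R$ and $L$, and $\mathrm{Aut}(\mathcal M)$ is the group of automorphisms in this sense. For a finite group $G$, a Cayley map $\mathcal M=\mathrm{Cay}(G,S,P)$ is given by a generating set $S=S^{-1}\not\ni1$ of $G$ and a cyclic permutation $P$ of $S$: its darts are the pairs $(g,x)\in G\times S$ (the arc from $g$ to $gx$), with $R(g,x)=(g,P(x))$ and $L(g,x)=(gx,x^{-1})$. Its valency is $|S|$, and it is regular if $\mathrm{Aut}(\mathcal M)$ is transitive on the darts. A skew-morphism of $G$ is a permutation $\sigma$ of $G$ with $\sigma(1)=1$ for which there is $\pi:G\to\mathbb Z$ with $\sigma(gh)=\sigma(g)\sigma^{\pi(g)}(h)$ for all $g,h\in G$; its skew-product group is the permutation group $L_G\langle\sigma\rangle$, where $L_G$ is the left regular representation of $G$. A regular Cayley map $\mathcal M$ on $G$ is balanced if $\mathrm{Aut}(\mathcal M)$ is isomorphic to the skew-product group $L_G\langle\sigma\rangle$ of some skew-morphism $\sigma$ of $G$ with $L_G\lhd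 L_G\langle\sigma\rangle$. For a group $X$, $\sigma\in X$ and an involution $\iota\in X$, $\mathcal M(X,\sigma,\iota)$ is the map with dart set $X$ whose rotation is right multiplication by $\sigma$ and whose dart reversal is right multiplication by $\iota$. $\mathrm{Inn}(r)$ denotes conjugation by $r$, and a bar denotes the image of a matrix of $\mathrm{SL}(2,p)$ in $\mathrm{PSL}(2,p)$. Let $p\ge5$ be prime, $G=\mathrm{PSL}(2,p)$ and $F'=\{1,2,\dots,\frac{p-1}2\}\subset\mathbb F_p$. For $a\in\mathbb F_p^*$ let $\lambda(a)$ be the element of $\{a,-a\}\cap F'$. Let $D(p)\subseteq F'$ consist of $1$; of $\lambda(\sqrt2)$ if $p\equiv\pm1\pmod 8$; of $\lambda(\sqrt3)$ if $p\equiv\pm1\pmod{12}$; and of $\lambda\big(\frac{-1+\sqrt5}2\big)$ and $\lambda\big(\frac{-1-\sqrt5}2\big)$ if $p\equiv\pm1\pmod 5$. For $\delta\in F'\setminus D(p)$ and a solution $(\alpha,\beta)\in\mathbb F_p^2$ of $\alpha^2+\beta^2-\alpha+\delta\beta+1=0$ put $$r_\delta=\overline{\begin{pmatrix}\alpha&\beta\\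 \beta+\delta&1-\alpha\end{pmatrix}},\qquad s=\overline{\begin{pmatrix}0&1\\-1&0\end{pmatrix}},\qquad \mathcal P(p,\delta)=\mathcal M\big(G\rtimes\langle\mathrm{Inn}(r_\delta)\rangle,\ \mathrm{Inn}(r_\delta),\ s\big).$$ For $c\in\{1,\dots,\frac{p-1}2\}$ put $$r=\overline{\begin{pmatrix}1&1\\0&1\end{pmatrix}},\qquad s_c=\overline{\begin{pmatrix}0&-\frac1c\\c&0\end{pmatrix}},\qquad \mathcal Q(p,c)=\mathcal M\big(G\rtimes\langle\mathrm{Inn}(r)\rangle,\ \mathrm{Inn}(r),\ s_c\big).$$ **Lemma 4.2.** Let $\mathcal M$ be a balanced regular Cayley map on $G=\mathrm{PSL}(2,p)$, $p\ge5$ prime. 1. If $\mathcal M$ has valency $3$, then there is $\delta\in F'\setminus D(p)$, for which the equation $\alpha^2+\beta^2-\alpha+\delta\beta+1=0$ has a solution in $\mathbb F_p^2$, such that $\mathcal M\cong\mathcal P(p,\delta)$, whichever solution $(\alpha,\beta)$ is used to define $\mathcal P(p,\delta)$. 2. If $\mathcal M$ has valency $p$, then $\mathcal M\cong\mathcal Q(p,c)$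 for some $c$ with $1\le c\le\frac{p-1}2$. -/

import Mathlib

open scoped MatrixGroups

/-- An oriented map, given by its set of darts (arcs), the rotation sending a dart to the next
dart around its initial vertex, and the fixed-point-free involution reversing every dart.
Vertices are the orbits of the rotation. -/
structure OrientedMap where
  Dart : Type
  rot : Equiv.Perm Dart
  rev : Equiv.Perm Dart
  rev_rev : ∀ d, rev (rev d) = d
  rev_ne : ∀ d, rev d ≠ d

namespace OrientedMap

/-- The (orientation-preserving) automorphism group: the permutations of the darts commuting
with the rotation and with the dart-reversing involution. -/
def Aut (M : OrientedMap) : Subgroup (Equiv.Perm M.Dart) :=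
  Subgroup.centralizer {M.rot, M.rev}

/-- An orientation-preserving isomorphism of oriented maps. -/
structure Iso (M N : OrientedMap) where
  toEquiv : M.Dart ≃ N.Dart
  map_rot : ∀ d, toEquiv (M.rot d) = N.rot (toEquiv d)
  map_rev : ∀ d, toEquiv (M.rev d) = N.rev (toEquiv d)

/-- Isomorphy of oriented maps. -/
def Isomorphic (M N : OrientedMap) : Prop := Nonempty (Iso M N)

/-- The map is regular: its automorphism group is transitive on darts. (For a connected map
the action on darts is then regular.) -/
def IsRegular (M : OrientedMap) : Prop :=
  ∀ d e : M.Dart, ∃ f ∈ M.Aut, f d = e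

/-- The map `M(X, σ, ι)` given by a group `X`, an element `σ` and an involution `ι`: the darts
are the elements of `X`, on which `X` acts by left multiplication; the rotation is right
multiplication by `σ`, so that the vertices are the left cosets of `⟨σ⟩`, and the dart reversal
is right multiplication by `ι`. The map is connected if and only if `X = ⟨σ, ι⟩`. -/
def ofGroup (X : Type) [Group X] (σ ι : X) (hι : ι * ι = 1) (hι1 : ι ≠ 1) : OrientedMap where
  Dart := X
  rot := Equiv.mulRight σ
  rev := Equiv.mulRight ι
  rev_rev d := by simp [mul_assoc, hι]
  rev_ne d := by simpa using hι1

end OrientedMap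

/-- A Cayley map `Cay(G, S, P)` on `G`: a finite generating set `S` of `G` which is closed under
inverses and does not contain `1`, with a cyclic permutation `P` of `S`. -/
structure CayleyMap (G : Type) [Group G] where
  S : Finset G
  one_notMem : (1 : G) ∉ S
  inv_mem : ∀ x ∈ S, x⁻¹ ∈ S
  closure_eq_top : Subgroup.closure (S : Set G) = ⊤
  P : Equiv.Perm S
  isCycleOn : P.IsCycleOn Set.univ

/-- A skew-morphism of `G`: a permutation `σ` of `G` fixing `1` such that for some integer
function `π` one has `σ (g h) = σ g * σ ^ (π g) h`. -/
def IsSkewMorphism {G : Type} [Group G] (σ : Equiv.Perm G) : Prop :=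
  σ 1 = 1 ∧ ∃ π : G → ℤ, ∀ g h : G, σ (g * h) = σ g * (σ ^ π g) h

/-- The left regular representation `L_G` of `G`, as a group of permutations. -/
def leftRegular (G : Type) [Group G] : Subgroup (Equiv.Perm G) :=
  (MulAction.toPermHom G G).range

/-- The skew-product group of `σ`: the permutation group generated by `L_G` and `σ`
(for a skew-morphism `σ` of a finite group it is the product set `L_G ⟨σ⟩`). -/
def skewProduct {G : Type} [Group G] (σ : Equiv.Perm G) : Subgroup (Equiv.Perm G) :=
  leftRegular G ⊔ Subgroup.zpowers σ

/-- The skew-product group of `σ` is balanced: `L_G` is normal in it. -/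
def IsBalancedSkewProduct {G : Type} [Group G] (σ : Equiv.Perm G) : Prop :=
  ((leftRegular G).subgroupOf (skewProduct σ)).Normal

namespace CayleyMap

variable {G : Type} [Group G]

/-- The oriented map of `Cay(G, S, P)`. The darts are the pairs `(g, x)`, standing for the arc
from `g` to `g x`; the rotation at `g` sends `(g, x)` to `(g, P x)`, and the reverse of `(g, x)`
is `(g x, x⁻¹)`. -/
def toMap (M : CayleyMap G) : OrientedMap where
  Dart := G × M.S
  rot := Equiv.prodCongr (Equiv.refl G) M.P
  rev :=
    { toFun := fun d => (d.1 * d.2, ⟨(d.2 : G)⁻¹, M.inv_mem _ d.2.2⟩)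
      invFun := fun d => (d.1 * d.2, ⟨(d.2 : G)⁻¹, M.inv_mem _ d.2.2⟩)
      left_inv := fun d => by simp
      right_inv := fun d => by simp }
  rev_rev d := by simp
  rev_ne d h := by
    have h1 : d.1 * (d.2 : G) = d.1 := congrArg Prod.fst h
    have h2 : (d.2 : G) = 1 := by simpa using h1
    exact M.one_notMem (h2 ▸ d.2.2)

/-- The valency of the map, i.e. of the underlying Cayley graph. -/
def valency (M : CayleyMap G) : ℕ := M.S.card

/-- A regular Cayley map. -/
def IsRegular (M : CayleyMap G) : Prop := M.toMap.IsRegular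

/-- A Cayley map on `G` is balanced if its automorphism group is (isomorphic to) the
skew-product group of some skew-morphism of `G` that is balanced. -/
def IsBalanced (M : CayleyMap G) : Prop :=
  ∃ σ : Equiv.Perm G, IsSkewMorphism σ ∧ IsBalancedSkewProduct σ ∧
    Nonempty (M.toMap.Aut ≃* skewProduct σ)

end CayleyMap

/-- The semidirect product `G : ⟨Inn r⟩`, where `Inn r` is conjugation by `r`. -/
abbrev InnSemidirect (G : Type) [Group G] (r : G) : Type :=
  G ⋊[(Subgroup.zpowers (MulAut.conj r)).subtype] (Subgroup.zpowers (MulAut.conj r))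

/-- The map `M(G : ⟨Inn r⟩, Inn r, s)` for `r ∈ G` and an involution `s ∈ G`. -/
def innMap (G : Type) [Group G] (r s : G) (hs : s * s = 1) (hs1 : s ≠ 1) : OrientedMap :=
  OrientedMap.ofGroup (InnSemidirect G r)
    (SemidirectProduct.inr ⟨MulAut.conj r, Subgroup.mem_zpowers _⟩)
    (SemidirectProduct.inl s)
    (by rw [← map_mul, hs, map_one])
    (fun h => hs1 (SemidirectProduct.inl_injective (h.trans (map_one _).symm)))

section PSL

variable (p : ℕ) [Fact p.Prime]

/-- A `2 × 2` matrix of determinant `1`, as an element of `SL(2, p)`. -/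
def slMk (A : Matrix (Fin 2) (Fin 2) (ZMod p)) (hA : A.det = 1) : SL(2, ZMod p) :=
  ⟨A, hA⟩

/-- The class in `PSL(2, p)` of a `2 × 2` matrix of determinant `1`. -/
def pslMk (A : Matrix (Fin 2) (Fin 2) (ZMod p)) (hA : A.det = 1) : PSL(2, ZMod p) :=
  QuotientGroup.mk (slMk p A hA)

/-- The set `F' = {1, 2, …, (p - 1) / 2}` in the field of `p` elements. -/
def halfSystem : Set (ZMod p) :=
  {a | ∃ k : ℕ, 1 ≤ k ∧ k ≤ (p - 1) / 2 ∧ a = (k : ZMod p)}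

/-- `λ(a) = {a, -a} ∩ F'`; for `a ≠ 0` this is a singleton. -/
def lam (a : ZMod p) : Set (ZMod p) := {a, -a} ∩ halfSystem p

/-- The set `D(p)`: it consists of `1`, of `λ(√2)` if `p ≡ ±1 (mod 8)`, of `λ(√3)` if
`p ≡ ±1 (mod 12)`, and of `λ((-1 ± √5) / 2)` if `p ≡ ±1 (mod 5)`. In each case the variable
`x` runs through both square roots. -/
def exceptionalSet : Set (ZMod p) :=
  {d | d = 1 ∨
    ((p % 8 = 1 ∨ p % 8 = 7) ∧ ∃ x : ZMod p, x ^ 2 = 2 ∧ d ∈ lam p x) ∨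
    ((p % 12 = 1 ∨ p % 12 = 11) ∧ ∃ x : ZMod p, x ^ 2 = 3 ∧ d ∈ lam p x) ∨
    ((p % 5 = 1 ∨ p % 5 = 4) ∧ ∃ x : ZMod p, x ^ 2 = 5 ∧ d ∈ lam p ((-1 + x) / 2))}

/-- The equation `α² + β² - α + δ β + 1 = 0`. -/
def IsSolution (δ α β : ZMod p) : Prop :=
  α ^ 2 + β ^ 2 - α + δ * β + 1 = 0

/-- The element `r_δ` of `PSL(2, p)` with rows `(α, β)` and `(β + δ, 1 - α)`. -/
def rElt (δ α β : ZMod p) (h : IsSolution p δ α β) : PSL(2, ZMod p) :=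
  pslMk p !![α, β; β + δ, 1 - α] (by
    rw [Matrix.det_fin_two_of]
    unfold IsSolution at h
    linear_combination -h)

/-- The element `s_c` of `PSL(2, p)` with rows `(0, -1/c)` and `(c, 0)`. -/
def sElt (c : (ZMod p)ˣ) : PSL(2, ZMod p) :=
  pslMk p !![0, -(1 / (c : ZMod p)); (c : ZMod p), 0] (by
    have hc : (c : ZMod p) ≠ 0 := c.ne_zero
    rw [Matrix.det_fin_two_of]
    field_simp
    ring)

/-- The element `s` of `PSL(2, p)` with rows `(0, 1)` and `(-1, 0)`. -/
def sStd : PSL(2, ZMod p) :=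
  pslMk p !![0, 1; -1, 0] (by rw [Matrix.det_fin_two_of]; simp)

/-- The element `r` of `PSL(2, p)` with rows `(1, 1)` and `(0, 1)`. -/
def uElt : PSL(2, ZMod p) :=
  pslMk p !![1, 1; 0, 1] (by rw [Matrix.det_fin_two_of]; simp)

theorem pslMk_mul_self (b c : ZMod p) (h : (!![0, b; c, 0] : Matrix _ _ _).det = 1) :
    pslMk p !![0, b; c, 0] h * pslMk p !![0, b; c, 0] h = 1 := by
  have h' := h
  rw [Matrix.det_fin_two_of] at h'
  have hbc : b * c = -1 := by linear_combination -h'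
  have hmem : slMk p !![0, b; c, 0] h * slMk p !![0, b; c, 0] h ∈
      Subgroup.center (SL(2, ZMod p)) := by
    rw [Matrix.SpecialLinearGroup.mem_center_iff]
    refine ⟨-1, by simp, ?_⟩
    rw [Matrix.SpecialLinearGroup.coe_mul]
    change _ = !![0, b; c, 0] * !![0, b; c, 0]
    ext i j
    fin_cases i <;> fin_cases j <;> simp [hbc, mul_comm c b]
  exact (QuotientGroup.eq_one_iff _).2 hmem

theorem pslMk_ne_one (b c : ZMod p) (h : (!![0, b; c, 0] : Matrix _ _ _).det = 1) :
    pslMk p !![0, b; c, 0] h ≠ 1 := by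
  intro h1
  have hmem := (QuotientGroup.eq_one_iff _).1 h1
  rw [Matrix.SpecialLinearGroup.mem_center_iff] at hmem
  obtain ⟨a, ha, hs⟩ := hmem
  change _ = !![0, b; c, 0] at hs
  have h0 : a = 0 := by simpa using congrFun (congrFun hs 0) 0
  simp [h0] at ha

/-- The map `P(p, δ) = M(PSL(2,p) : ⟨Inn r_δ⟩, Inn r_δ, s)`, for a chosen solution `(α, β)` of
`α² + β² - α + δ β + 1 = 0`. -/
def mapP (δ α β : ZMod p) (h : IsSolution p δ α β) : OrientedMap :=
  innMap (PSL(2, ZMod p)) (rElt p δ α β h) (sStd p)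
    (pslMk_mul_self p _ _ _) (pslMk_ne_one p _ _ _)

/-- The map `Q(p, c) = M(PSL(2,p) : ⟨Inn r⟩, Inn r, s_c)`. -/
def mapQ (c : (ZMod p)ˣ) : OrientedMap :=
  innMap (PSL(2, ZMod p)) (uElt p) (sElt p c)
    (pslMk_mul_self p _ _ _) (pslMk_ne_one p _ _ _)

end PSL

/-! Balance is turned into algebra inside `G = PSL(2,p)`. Left translations embed `G` in `Aut M`.
The skew-product group modulo a normal `L_G` is cyclic, and the simple nonabelian group `G` has only
trivial maps to commutative groups, so by counting the translations correspond exactly to `L_G` and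
are normal in `Aut M` (`IsBalanced.normal_range_leftAut`). Conjugation by a map automorphism that
turns the darts at `1` by one step then induces an automorphism `τ` of `G` extending `P`
(`exists_mulAut_eq_P`).

For odd valency `n`, inversion fixes some `x ∈ S`, an involution, and `τ ^ n = 1`. Every
automorphism of `PSL(2,p)` comes from `GL(2,p)`, and those of odd order are inner
(`conjGL_surjective`, `exists_conj_eq_of_odd`), so `τ = Inn(r)` with `r ^ n = 1`. As `S` is the
`τ`-orbit of `x`, the pair `(r, x)` generates `G`, and its class under `Aut G` determines the map
(`isomorphic_innMap`). It remains to find normal forms of such pairs under `GL(2,p)`.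

For `n = p`, make `r` unitriangular. Then `x` is not upper triangular, and a unitriangular
conjugation gives it zero diagonal. For `n = 3`, make `x` equal to `s` and give `r` trace `1`. The
trace `δ` of `r * s` is then the only invariant, up to sign (`exists_conjGL_rElt_eq`). The values in
`D(p)` would force `(r * s) ^ n = 1` for some `n` among 3, 4, 5, 6, and `δ = 0` gives `n = 2`. The
corresponding triangle groups are dihedral, `A₄`, `S₄`, `A₅` or Euclidean, and `G` is not a quotient
of them, apart from `A₅` when `p = 5`. This is proved through actions on fewer than `p` points
(`smul_eq_of_card_lt`), and for `n = 6` through an abelian normal subgroup. -/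

set_option linter.unusedSimpArgs false
set_option linter.unusedSectionVars false

/-! ### Unitriangular generators of `PSL(2,p)` and consequences of simplicity. -/

section ProjectiveSpecialLinear

variable {p : ℕ} [Fact p.Prime]

theorem pslMk_mul (A B : Matrix (Fin 2) (Fin 2) (ZMod p)) (hA : A.det = 1) (hB : B.det = 1) :
    pslMk p A hA * pslMk p B hB =
      pslMk p (A * B) (by rw [Matrix.det_mul, hA, hB, one_mul]) := rfl

theorem exists_eq_pslMk (g : PSL(2, ZMod p)) : ∃ A hA, g = pslMk p A hA := by
  induction g using QuotientGroup.induction_on with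
  | H A => exact ⟨A.1, A.2, rfl⟩

theorem det_neg_two {A : Matrix (Fin 2) (Fin 2) (ZMod p)} (hA : A.det = 1) : (-A).det = 1 := by
  simpa [Matrix.det_fin_two] using hA

theorem pslMk_eq_one_iff (A : Matrix (Fin 2) (Fin 2) (ZMod p)) (hA : A.det = 1) :
    pslMk p A hA = 1 ↔ A = 1 ∨ A = -1 := by
  unfold pslMk
  rw [QuotientGroup.eq_one_iff, Matrix.SpecialLinearGroup.mem_center_iff]
  constructor
  · rintro ⟨r, hr, h⟩
    have hr' : r ^ 2 = 1 := by simpa using hr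
    change _ = A at h
    rcases mul_self_eq_one_iff.mp ((sq r).symm.trans hr') with rfl | rfl
    · left; rw [← h]; simp
    · right; rw [← h]; ext i j; fin_cases i <;> fin_cases j <;> simp
  · rintro (h | h)
    · refine ⟨1, by simp, ?_⟩
      change _ = A
      simp [h]
    · refine ⟨-1, by simp, ?_⟩
      change _ = A
      rw [h]; ext i j; fin_cases i <;> fin_cases j <;> simp

theorem pslMk_eq_iff (A B : Matrix (Fin 2) (Fin 2) (ZMod p)) (hA : A.det = 1) (hB : B.det = 1) :
    pslMk p A hA = pslMk p B hB ↔ A = B ∨ A = -B := by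
  have hadj : (Matrix.adjugate B).det = 1 := by
    simp [Matrix.det_fin_two, Matrix.adjugate_fin_two] at hB ⊢
    linear_combination hB
  have hinv : pslMk p B hB * pslMk p (Matrix.adjugate B) hadj = 1 := by
    rw [pslMk_mul, pslMk_eq_one_iff, Matrix.mul_adjugate, hB]; simp
  have hBB : Matrix.adjugate B * B = 1 := by rw [Matrix.adjugate_mul, hB]; simp
  have hBB' : B * Matrix.adjugate B = 1 := by rw [Matrix.mul_adjugate, hB]; simp
  rw [← mul_inv_eq_one, ← eq_inv_of_mul_eq_one_right hinv, pslMk_mul, pslMk_eq_one_iff]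
  constructor
  · rintro (h | h)
    · left
      have := congrArg (· * B) h
      simpa [mul_assoc, hBB] using this
    · right
      have := congrArg (· * B) h
      simpa [mul_assoc, hBB] using this
  · rintro (rfl | rfl)
    · left; exact hBB'
    · right; simp [hBB']

theorem pslMk_neg (A : Matrix (Fin 2) (Fin 2) (ZMod p)) (hA : A.det = 1) :
    pslMk p A hA = pslMk p (-A) (det_neg_two hA) :=
  (pslMk_eq_iff _ _ _ _).2 (Or.inr (by simp))

theorem pslMk_pow (A : Matrix (Fin 2) (Fin 2) (ZMod p)) (hA : A.det = 1) (n : ℕ) :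
    pslMk p A hA ^ n = pslMk p (A ^ n) (by rw [Matrix.det_pow, hA, one_pow]) := by
  induction n with
  | zero => simp only [pow_zero]; rfl
  | succ n ih => simp only [pow_succ, ih, pslMk_mul]

/-- The class of the upper unitriangular matrix with entry `x`. -/
def upperUni (p : ℕ) [Fact p.Prime] (x : ZMod p) : PSL(2, ZMod p) :=
  pslMk p !![1, x; 0, 1] (by simp [Matrix.det_fin_two])

/-- The class of the lower unitriangular matrix with entry `x`. -/
def lowerUni (p : ℕ) [Fact p.Prime] (x : ZMod p) : PSL(2, ZMod p) :=
  pslMk p !![1, 0; x, 1] (by simp [Matrix.det_fin_two])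

theorem upperUni_add (x y : ZMod p) : upperUni p (x + y) = upperUni p x * upperUni p y := by
  simp only [upperUni, pslMk_mul]
  congr 1
  ext i j; fin_cases i <;> fin_cases j <;> simp [add_comm]

theorem lowerUni_add (x y : ZMod p) : lowerUni p (x + y) = lowerUni p x * lowerUni p y := by
  simp only [lowerUni, pslMk_mul]
  congr 1
  ext i j; fin_cases i <;> fin_cases j <;> simp

theorem upperUni_zero : upperUni p 0 = 1 := by
  rw [upperUni, pslMk_eq_one_iff]; left; ext i j; fin_cases i <;> fin_cases j <;> rfl

theorem lowerUni_zero : lowerUni p 0 = 1 := by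
  rw [lowerUni, pslMk_eq_one_iff]; left; ext i j; fin_cases i <;> fin_cases j <;> rfl

theorem upperUni_pow (x : ZMod p) (n : ℕ) : upperUni p x ^ n = upperUni p (n * x) := by
  induction n with
  | zero => simp [upperUni_zero]
  | succ n ih => rw [pow_succ, ih, ← upperUni_add]; congr 1; push_cast; ring

theorem lowerUni_pow (x : ZMod p) (n : ℕ) : lowerUni p x ^ n = lowerUni p (n * x) := by
  induction n with
  | zero => simp [lowerUni_zero]
  | succ n ih => rw [pow_succ, ih, ← lowerUni_add]; congr 1; push_cast; ring

theorem upperUni_neg (x : ZMod p) : upperUni p (-x) = (upperUni p x)⁻¹ :=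
  eq_inv_of_mul_eq_one_left (by rw [← upperUni_add]; simp [upperUni_zero])

theorem lowerUni_neg (x : ZMod p) : lowerUni p (-x) = (lowerUni p x)⁻¹ :=
  eq_inv_of_mul_eq_one_left (by rw [← lowerUni_add]; simp [lowerUni_zero])

theorem upperUni_mem_of_ne_zero {K : Subgroup PSL(2, ZMod p)} {x : ZMod p} (hx : x ≠ 0)
    (h : upperUni p x ∈ K) (y : ZMod p) : upperUni p y ∈ K := by
  have := K.pow_mem h (y / x).val
  rwa [upperUni_pow, ZMod.natCast_zmod_val, div_mul_cancel₀ _ hx] at this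

theorem lowerUni_mem_of_ne_zero {K : Subgroup PSL(2, ZMod p)} {x : ZMod p} (hx : x ≠ 0)
    (h : lowerUni p x ∈ K) (y : ZMod p) : lowerUni p y ∈ K := by
  have := K.pow_mem h (y / x).val
  rwa [lowerUni_pow, ZMod.natCast_zmod_val, div_mul_cancel₀ _ hx] at this

/-- Nontrivial upper and lower unitriangular classes generate `PSL(2, p)`. -/
theorem eq_top_of_uni_mem {K : Subgroup PSL(2, ZMod p)} {x y : ZMod p} (hx : x ≠ 0) (hy : y ≠ 0)
    (hU : upperUni p x ∈ K) (hV : lowerUni p y ∈ K) : K = ⊤ := by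
  have hU' := upperUni_mem_of_ne_zero hx hU
  have hV' := lowerUni_mem_of_ne_zero hy hV
  -- When the lower left entry is nonzero the matrix factors as upper, lower, upper. The other case
  -- is brought here by a left factor `lowerUni p 1`.
  have key : ∀ a b c d : ZMod p, ∀ h : (!![a, b; c, d] : Matrix _ _ _).det = 1, c ≠ 0 →
      pslMk p !![a, b; c, d] h ∈ K := by
    intro a b c d h hc
    have : pslMk p !![a, b; c, d] h =
        upperUni p ((a - 1) / c) * lowerUni p c * upperUni p ((d - 1) / c) := by
      simp only [upperUni, lowerUni, pslMk_mul]
      rw [Matrix.det_fin_two_of] at h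
      congr 1
      ext i j; fin_cases i <;> fin_cases j <;> simp <;> field_simp <;>
        first | ring1 | linear_combination -h
    rw [this]
    exact K.mul_mem (K.mul_mem (hU' _) (hV' _)) (hU' _)
  rw [eq_top_iff]
  rintro g -
  obtain ⟨A, hA, rfl⟩ := exists_eq_pslMk g
  obtain ⟨a, b, c, d, rfl⟩ : ∃ a b c d, A = !![a, b; c, d] :=
    ⟨_, _, _, _, Matrix.eta_fin_two A⟩
  by_cases hc : c = 0
  · have ha : a ≠ 0 := by
      rintro rfl
      simp [hc] at hA
    have h1 : lowerUni p 1 * pslMk p !![a, b; c, d] hA ∈ K := by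
      simp only [lowerUni, pslMk_mul]
      have := key a b (a + c) (b + d) (by
        rw [Matrix.det_fin_two_of] at hA ⊢; linear_combination hA) (by simpa [hc] using ha)
      convert this using 2
      ext i j; fin_cases i <;> fin_cases j <;> simp
    exact (K.mul_mem_cancel_left (hV' 1)).1 h1
  · exact key _ _ _ _ hA hc

theorem two_ne_zero_zmod (hp : 5 ≤ p) : (2 : ZMod p) ≠ 0 := by
  have h : ((2 : ℕ) : ZMod p) ≠ 0 := by
    rw [Ne, ZMod.natCast_eq_zero_iff]
    exact fun h => by have := Nat.le_of_dvd (by norm_num) h; omega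
  exact_mod_cast h

theorem not_commute_upperUni_lowerUni (hp : 5 ≤ p) {x y : ZMod p} (hx : x ≠ 0) (hy : y ≠ 0) :
    ¬ Commute (upperUni p x) (lowerUni p y) := by
  intro h
  have h' : upperUni p x * lowerUni p y = lowerUni p y * upperUni p x := h
  simp only [upperUni, lowerUni, pslMk_mul] at h'
  rw [pslMk_eq_iff] at h'
  rcases h' with h' | h'
  · have := congrFun (congrFun h' 0) 0
    simp at this
    tauto
  · have := congrFun (congrFun h' 0) 1
    simp at this
    have h2 : 2 * x = 0 := by linear_combination this
    exact (mul_ne_zero (two_ne_zero_zmod hp) hx) h2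

theorem exists_not_commute_psl (hp : 5 ≤ p) : ∃ a b : PSL(2, ZMod p), ¬ Commute a b :=
  ⟨_, _, not_commute_upperUni_lowerUni hp one_ne_zero one_ne_zero⟩

theorem isSimpleGroup_psl (hp : 5 ≤ p) : IsSimpleGroup PSL(2, ZMod p) :=
  Matrix.ProjectiveSpecialLinearGroup.rank_two_simple (by simp; omega)

/-- Every homomorphism from `PSL(2, p)`, `p ≥ 5`, to a commutative group is trivial. -/
theorem hom_eq_one_of_commute (hp : 5 ≤ p) {Q : Type*} [Group Q] (hQ : ∀ a b : Q, Commute a b)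
    (f : PSL(2, ZMod p) →* Q) (g : PSL(2, ZMod p)) : f g = 1 := by
  have := isSimpleGroup_psl hp
  rcases (inferInstance : f.ker.Normal).eq_bot_or_eq_top with h | h
  · obtain ⟨a, b, hab⟩ := exists_not_commute_psl (p := p) hp
    refine absurd ?_ hab
    apply (MonoidHom.ker_eq_bot_iff f).1 h
    rw [map_mul, map_mul]
    exact hQ _ _
  · exact MonoidHom.mem_ker.1 (h ▸ Subgroup.mem_top g)

theorem eq_one_of_commute_all (hp : 5 ≤ p) {x : PSL(2, ZMod p)} (h : ∀ g, Commute g x) :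
    x = 1 := by
  have := isSimpleGroup_psl hp
  have hx : x ∈ Subgroup.center PSL(2, ZMod p) := Subgroup.mem_center_iff.2 h
  rcases (inferInstance : (Subgroup.center PSL(2, ZMod p)).Normal).eq_bot_or_eq_top with h | h
  · rw [h] at hx; exact hx
  · obtain ⟨a, b, hab⟩ := exists_not_commute_psl (p := p) hp
    have hb : b ∈ Subgroup.center PSL(2, ZMod p) := h ▸ Subgroup.mem_top b
    exact absurd (Subgroup.mem_center_iff.1 hb a) hab

end ProjectiveSpecialLinear

/-! ### Generating pairs do not satisfy small triangle group relations. -/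

section SmallOrbits

variable {p : ℕ} [Fact p.Prime]

/-- `PSL(2, p)` fixes every point of an invariant set of fewer than `p` points. -/
theorem smul_eq_of_card_lt {X : Type*} (act : PSL(2, ZMod p) → X → X)
    (act_one : ∀ x, act 1 x = x) (act_mul : ∀ g h x, act (g * h) x = act g (act h x))
    {T : Set PSL(2, ZMod p)} (hT : Subgroup.closure T = ⊤) (F : Finset X) (hF : F.card < p)
    (hTF : ∀ t ∈ T, ∀ x ∈ F, act t x ∈ F) (g : PSL(2, ZMod p)) {x : X} (hx : x ∈ F) :
    act g x = x := by
  classical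
  have inv_act : ∀ g x, act g⁻¹ (act g x) = x := fun g x => by
    rw [← act_mul, inv_mul_cancel, act_one]
  have hinj : ∀ g, Function.Injective (act g) := fun g => Function.LeftInverse.injective (inv_act g)
  have himage : ∀ g, (∀ x ∈ F, act g x ∈ F) → F.image (act g) = F := fun g hg =>
    Finset.eq_of_subset_of_card_le (Finset.image_subset_iff.2 hg)
      (Finset.card_image_of_injective _ (hinj g)).ge
  have hall : ∀ g, ∀ x ∈ F, act g x ∈ F := by
    intro g
    have hg : g ∈ Subgroup.closure T := hT ▸ Subgroup.mem_top g
    induction hg using Subgroup.closure_induction with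
    | mem t ht => exact hTF t ht
    | one => intro x hx; rwa [act_one]
    | mul a b _ _ ha hb => intro x hx; rw [act_mul]; exact ha _ (hb _ hx)
    | inv a _ ha =>
      intro x hx
      rw [← himage a ha] at hx
      obtain ⟨y, hy, rfl⟩ := Finset.mem_image.1 hx
      rwa [inv_act]
  let K : Subgroup PSL(2, ZMod p) :=
    { carrier := {g | act g x = x}
      one_mem' := act_one x
      mul_mem' := fun {a b} ha hb => by
        change act (a * b) x = x
        rw [act_mul, (hb : act b x = x), (ha : act a x = x)]
      inv_mem' := fun {a} ha => by
        change act a⁻¹ x = x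
        conv_lhs => rw [← (ha : act a x = x)]
        exact inv_act a x }
  have hone : ∀ W : ZMod p → PSL(2, ZMod p), (∀ a b, W (a + b) = W a * W b) →
      (∀ a, W (-a) = (W a)⁻¹) → ∃ a, a ≠ 0 ∧ W a ∈ K := by
    intro W hadd hneg
    -- Pigeonhole: the `p` elements of a root subgroup send `x` into fewer than `p` points, so a
    -- nontrivial one fixes `x`.
    obtain ⟨a, -, b, -, hab, h⟩ := Finset.exists_ne_map_eq_of_card_lt_of_maps_to
      (s := (Finset.univ : Finset (ZMod p))) (t := F) (f := fun a => act (W a) x)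
      (by rw [Finset.card_univ, ZMod.card]; exact hF) (fun a _ => hall _ _ hx)
    refine ⟨-a + b, fun h0 => hab (by linear_combination -h0), ?_⟩
    change act (W (-a + b)) x = x
    rw [hadd, act_mul, ← h, hneg, inv_act]
  obtain ⟨a, ha, haK⟩ := hone _ upperUni_add upperUni_neg
  obtain ⟨b, hb, hbK⟩ := hone _ lowerUni_add lowerUni_neg
  exact (eq_top_of_uni_mem ha hb haK hbK ▸ Subgroup.mem_top g : g ∈ K)

variable {r s : PSL(2, ZMod p)}

theorem eq_one_of_conj_finset (hp : 5 ≤ p) (hrs : Subgroup.closure {r, s} = ⊤)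
    (F : Finset PSL(2, ZMod p)) (hF : F.card < p) (hr : ∀ x ∈ F, r * x * r⁻¹ ∈ F)
    (hs : ∀ x ∈ F, s * x * s⁻¹ ∈ F) {x : PSL(2, ZMod p)} (hx : x ∈ F) : x = 1 := by
  refine eq_one_of_commute_all hp fun g => ?_
  have := smul_eq_of_card_lt (fun g x => g * x * g⁻¹) (by simp) (by intros; group) hrs F hF
    (by rintro t (rfl | rfl) x hx; exacts [hr x hx, hs x hx]) g hx
  exact mul_inv_eq_iff_eq_mul.1 this

theorem not_commute_of_closure_eq_top (hp : 5 ≤ p) (hrs : Subgroup.closure {r, s} = ⊤) :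
    ¬ Commute r s := by
  intro h
  obtain ⟨a, b, hab⟩ := exists_not_commute_psl (p := p) hp
  have hcomm : IsMulCommutative (Subgroup.closure {r, s}) :=
    Subgroup.isMulCommutative_closure (by
      rintro x (rfl | rfl) y (rfl | rfl)
      exacts [rfl, h, h.symm, rfl])
  refine hab ?_
  have ha : a ∈ Subgroup.closure {r, s} := hrs ▸ Subgroup.mem_top a
  have hb : b ∈ Subgroup.closure {r, s} := hrs ▸ Subgroup.mem_top b
  exact congrArg Subtype.val (hcomm.is_comm.comm ⟨a, ha⟩ ⟨b, hb⟩)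

theorem ne_one_of_closure_eq_top (hp : 5 ≤ p) (hrs : Subgroup.closure {r, s} = ⊤) :
    r ≠ 1 ∧ s ≠ 1 := by
  constructor <;> rintro rfl <;> refine not_commute_of_closure_eq_top hp hrs ?_
  exacts [Commute.one_left _, Commute.one_right _]

/-- Dihedral case: `s` inverts `r`, so `{r, r⁻¹}` is stable under conjugation. -/
theorem mul_pow_two_ne_one (hp : 5 ≤ p) (hrs : Subgroup.closure {r, s} = ⊤) (hs : s * s = 1) :
    (r * s) ^ 2 ≠ 1 := by
  classical
  intro h
  have hs' : s⁻¹ = s := inv_eq_of_mul_eq_one_right hs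
  have h1 : s * r * s⁻¹ = r⁻¹ := by
    rw [hs', eq_comm, inv_eq_iff_mul_eq_one, ← h]; simp [pow_succ, mul_assoc]
  have h2 : s * r⁻¹ * s⁻¹ = r := by rw [← conj_inv, h1, inv_inv]
  refine (ne_one_of_closure_eq_top hp hrs).1
    (eq_one_of_conj_finset hp hrs {r, r⁻¹} (lt_of_le_of_lt Finset.card_le_two (by omega))
      ?_ ?_ (by simp : r ∈ _))
  · simp
  · simp [h1, h2]

theorem mul_self_eq_inv_of_pow_three {G : Type*} [Group G] {r : G} (hr : r ^ 3 = 1) :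
    r * r = r⁻¹ := by
  rw [eq_inv_iff_mul_eq_one, ← hr]; simp [pow_succ]

theorem inv_mul_inv_of_pow_three {G : Type*} [Group G] {r : G} (hr : r ^ 3 = 1) :
    r⁻¹ * r⁻¹ = r := by
  rw [← mul_inv_rev, mul_self_eq_inv_of_pow_three hr, inv_inv]

theorem mul_mul_of_pow_three {G : Type*} [Group G] {r : G} (hr : r ^ 3 = 1) (x : G) :
    r * (r * x) = r⁻¹ * x := by
  rw [← mul_assoc, mul_self_eq_inv_of_pow_three hr]

theorem inv_mul_inv_mul_of_pow_three {G : Type*} [Group G] {r : G} (hr : r ^ 3 = 1) (x : G) :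
    r⁻¹ * (r⁻¹ * x) = r * x := by
  rw [← mul_assoc, inv_mul_inv_of_pow_three hr]

theorem mul_mul_of_mul_self {G : Type*} [Group G] {s : G} (hs : s * s = 1) (x : G) :
    s * (s * x) = x := by
  rw [← mul_assoc, hs, one_mul]

/-- The relations are those of `A₄`, where `s` has only three conjugates. -/
theorem mul_pow_three_ne_one (hp : 5 ≤ p) (hrs : Subgroup.closure {r, s} = ⊤) (hr : r ^ 3 = 1)
    (hs : s * s = 1) : (r * s) ^ 3 ≠ 1 := by
  classical
  intro h
  have hs' : s⁻¹ = s := inv_eq_of_mul_eq_one_right hs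
  have a1 := mul_self_eq_inv_of_pow_three hr
  have a2 := inv_mul_inv_of_pow_three hr
  have a3 := mul_mul_of_pow_three hr
  have a4 := inv_mul_inv_mul_of_pow_three hr
  have a5 := mul_mul_of_mul_self hs
  have e1 : s * (r * s) = r⁻¹ * (s * r⁻¹) := by
    have := congrArg (fun z => r⁻¹ * z * s * r⁻¹) h
    simpa [pow_succ, mul_assoc, hs, hs', a1, a2, a3, a4, a5] using this
  have e2 : s * (r⁻¹ * s) = r * (s * r) := by
    have := congrArg (fun z => z⁻¹) e1
    simpa [mul_assoc, hs'] using this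
  have e3 : ∀ x, s * (r * (s * x)) = r⁻¹ * (s * (r⁻¹ * x)) := fun x => by
    have := congrArg (· * x) e1
    simpa [mul_assoc] using this
  have e4 : ∀ x, s * (r⁻¹ * (s * x)) = r * (s * (r * x)) := fun x => by
    have := congrArg (· * x) e2
    simpa [mul_assoc] using this
  refine (ne_one_of_closure_eq_top hp hrs).2
    (eq_one_of_conj_finset hp hrs {s, r * (s * r⁻¹), r⁻¹ * (s * r)}
      (lt_of_le_of_lt Finset.card_le_three (by omega)) ?_ ?_ (by simp : s ∈ _))
  · simp [mul_assoc, a1, a2, a3]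
  · simp [mul_assoc, hs, hs', a1, a2, a3, a4, a5, e1, e2, e3, e4]

/-- The relations are those of `S₄`, where `(r * s) ^ 2` is one of the three double transpositions.
If these are central, `(r * s) ^ 2 = 1`, the dihedral case. -/
theorem mul_pow_four_ne_one (hp : 5 ≤ p) (hrs : Subgroup.closure {r, s} = ⊤) (hr : r ^ 3 = 1)
    (hs : s * s = 1) : (r * s) ^ 4 ≠ 1 := by
  classical
  intro h
  have hs' : s⁻¹ = s := inv_eq_of_mul_eq_one_right hs
  have a1 := mul_self_eq_inv_of_pow_three hr
  have a2 := inv_mul_inv_of_pow_three hr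
  have a3 := mul_mul_of_pow_three hr
  have a4 := inv_mul_inv_mul_of_pow_three hr
  have a5 := mul_mul_of_mul_self hs
  have e1 : s * (r⁻¹ * (s * r⁻¹)) = r * (s * (r * s)) := by
    have := congrArg (fun z => z * s * r⁻¹ * s * r⁻¹) h
    simpa [pow_succ, mul_assoc, hs, hs', a1, a2, a3, a4, a5] using this.symm
  have e2 : r⁻¹ * (s * (r⁻¹ * s)) = s * (r * (s * r)) := by
    have := congrArg (fun z => r⁻¹ * z * r) e1
    simpa [mul_assoc, a1, a2, a3, a4, a5] using this
  have e3 : s * (r⁻¹ * (s * (r * (s * (r⁻¹ * s))))) = r * (s * (r⁻¹ * (s * r))) := by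
    have := congrArg₂ (· * ·) e1 e2
    simpa [mul_assoc, a1, a2, a3, a4, a5] using this
  have e4 : r * (s * (r⁻¹ * (s * r))) = r⁻¹ * (s * (r * (s * r⁻¹))) := by
    have := congrArg (fun z => r⁻¹ * r⁻¹ * z * s * r⁻¹ * s * r) h
    simpa [pow_succ, mul_assoc, a1, a2, a3, a4, a5] using this.symm
  refine mul_pow_two_ne_one hp hrs hs
    (eq_one_of_conj_finset hp hrs
      {r * (s * (r * s)), r⁻¹ * (s * (r * (s * r⁻¹))), s * (r * (s * r))}
      (lt_of_le_of_lt Finset.card_le_three (by omega)) ?_ ?_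
      (by simp [pow_succ, mul_assoc] : (r * s) ^ 2 ∈ _))
  · simp [mul_assoc, a1, a2, a3, a4]
  · simp [mul_assoc, hs, hs', a5, e3, e4]

/-- The relations are those of `A₅`, which permutes its six Sylow 5-subgroups. The bound excludes `p
= 5`, where `PSL(2,5)` is itself `A₅`. -/
theorem mul_pow_five_ne_one (hp : 6 < p) (hrs : Subgroup.closure {r, s} = ⊤) (hr : r ^ 3 = 1)
    (hs : s * s = 1) : (r * s) ^ 5 ≠ 1 := by
  classical
  intro h
  have hs' : s⁻¹ = s := inv_eq_of_mul_eq_one_right hs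
  have a1 := mul_self_eq_inv_of_pow_three hr
  have a2 := inv_mul_inv_of_pow_three hr
  have a3 := mul_mul_of_pow_three hr
  have a4 := inv_mul_inv_mul_of_pow_three hr
  have a5 := mul_mul_of_mul_self hs
  have e1 : s * (r⁻¹ * (s * (r⁻¹ * s))) = r * (s * (r * (s * r))) := by
    have := congrArg (fun z => z * s * r⁻¹ * s * r⁻¹ * s) h
    simpa [pow_succ, mul_assoc, hs, hs', a1, a2, a3, a4, a5] using this.symm
  have e2 : s * (r * (s * (r * (s * (r * s))))) = r⁻¹ * (s * r⁻¹) := by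
    have := congrArg (fun z => s * z * s) e1
    simpa [mul_assoc, hs, a5] using this.symm
  -- An unordered pair `{w, w⁻¹}` stands for the cyclic subgroup of `w`. This turns twelve
  -- conjugates of `r * s` into six points.
  let pair : PSL(2, ZMod p) → Sym2 PSL(2, ZMod p) := fun w => s(w, w⁻¹)
  have pair_inv : ∀ w, pair w⁻¹ = pair w := fun w => by
    simp only [pair, inv_inv]; exact Sym2.eq_swap
  have act_pair : ∀ g w, Sym2.map (fun x => g * x * g⁻¹) (pair w) = pair (g * w * g⁻¹) :=
    fun g w => by simp [pair, mul_assoc]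
  have key := smul_eq_of_card_lt (fun g z => Sym2.map (fun x => g * x * g⁻¹) z) (by simp)
    (fun g h z => by rw [Sym2.map_map]; congr 1; ext x; simp [mul_assoc]) hrs
    ({pair (r * s), pair (s * r), pair (r⁻¹ * (s * r⁻¹)), pair (r * (s * (r * (s * r)))),
      pair (r⁻¹ * (s * (r * s))), pair (s * (r * (s * r⁻¹)))})
    (lt_of_le_of_lt Finset.card_le_six hp)
    (by
      have i1 : pair (s * (r⁻¹ * (s * r))) = pair (r⁻¹ * (s * (r * s))) := by
        rw [← pair_inv]; simp [mul_assoc, hs']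
      have i2 : pair (r * (s * (r⁻¹ * s))) = pair (s * (r * (s * r⁻¹))) := by
        rw [← pair_inv]; simp [mul_assoc, hs']
      rintro t (rfl | rfl) x hx <;>
        simp only [Finset.mem_insert, Finset.mem_singleton] at hx <;>
        rcases hx with rfl | rfl | rfl | rfl | rfl | rfl <;>
        simp only [act_pair] <;>
        simp [mul_assoc, hs, hs', a1, a2, a3, a4, a5, e1, e2, i1, i2])
  have hw : ∀ g, g * (r * s) * g⁻¹ = r * s ∨ g * (r * s) * g⁻¹ = (r * s)⁻¹ := fun g => by
    have := key g (x := pair (r * s)) (by simp)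
    rw [act_pair] at this
    simp only [pair, Sym2.eq_iff] at this
    tauto
  have hw' : ∀ g, ∀ x ∈ ({r * s, (r * s)⁻¹} : Finset PSL(2, ZMod p)),
      g * x * g⁻¹ ∈ ({r * s, (r * s)⁻¹} : Finset PSL(2, ZMod p)) := by
    intro g x hx
    simp only [Finset.mem_insert, Finset.mem_singleton] at hx ⊢
    rcases hx with rfl | rfl
    · exact hw g
    · rw [← conj_inv]
      rcases hw g with h | h <;> rw [h] <;> simp
  have h1 : r * s = 1 := eq_one_of_conj_finset (by omega) hrs _
    (lt_of_le_of_lt Finset.card_le_two (by omega)) (hw' r) (hw' s) (by simp)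
  refine not_commute_of_closure_eq_top (by omega) hrs ?_
  rw [eq_inv_of_mul_eq_one_left h1]
  exact (Commute.refl s).inv_left

/-- Conjugation need only be tested on generators, not on their inverses: in a finite group an
inverse is a positive power. -/
theorem normal_closure_of_conj_mem {G : Type*} [Group G] [Finite G] {T X : Set G}
    (hT : Subgroup.closure T = ⊤) (h : ∀ t ∈ T, ∀ x ∈ X, t * x * t⁻¹ ∈ Subgroup.closure X) :
    (Subgroup.closure X).Normal := by
  have hle : ∀ t ∈ T, ∀ n ∈ Subgroup.closure X, t * n * t⁻¹ ∈ Subgroup.closure X := by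
    intro t ht n hn
    induction hn using Subgroup.closure_induction with
    | mem x hx => exact h t ht x hx
    | one => simp
    | mul a b _ _ ha hb => simpa [mul_assoc] using mul_mem ha hb
    | inv a _ ha => simpa [mul_assoc] using inv_mem ha
  constructor
  intro n hn g
  have hg : g ∈ Subgroup.closure T := hT ▸ Subgroup.mem_top g
  induction hg using Subgroup.closure_induction generalizing n with
  | mem t ht => exact hle t ht n hn
  | one => simpa
  | mul a b _ _ ha hb => simpa [mul_assoc] using ha _ (hb n hn)
  | inv a _ ha =>
    have hpow : ∀ k : ℕ, ∀ n ∈ Subgroup.closure X, a ^ k * n * (a ^ k)⁻¹ ∈ Subgroup.closure X := by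
      intro k
      induction k with
      | zero => simp
      | succ k ih =>
        intro n hn
        simpa [pow_succ, mul_assoc] using ih _ (ha n hn)
    obtain ⟨k, hk⟩ := mem_powers_iff_mem_zpowers.2
      (Subgroup.inv_mem _ (Subgroup.mem_zpowers a))
    rw [← hk]
    exact hpow k n hn

/-- The Euclidean triangle group `(2,3,6)` has an abelian normal subgroup of translations, generated
here by the commutator `a` and its conjugate `b`. By simplicity it is trivial or everything, and
either way `G` would be commutative. -/
theorem mul_pow_six_ne_one (hp : 5 ≤ p) (hrs : Subgroup.closure {r, s} = ⊤) (hr : r ^ 3 = 1)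
    (hs : s * s = 1) : (r * s) ^ 6 ≠ 1 := by
  intro h
  have hs' : s⁻¹ = s := inv_eq_of_mul_eq_one_right hs
  have a1 := mul_self_eq_inv_of_pow_three hr
  have a2 := inv_mul_inv_of_pow_three hr
  have a3 := mul_mul_of_pow_three hr
  have a4 := inv_mul_inv_mul_of_pow_three hr
  have a5 := mul_mul_of_mul_self hs
  have e1 : s * (r⁻¹ * (s * (r⁻¹ * (s * (r⁻¹ * s))))) = r * (s * (r * (s * r))) := by
    have := congrArg (fun z => z * s * r⁻¹ * s * r⁻¹ * s * r⁻¹ * s) h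
    simpa [pow_succ, mul_assoc, hs, hs', a1, a2, a3, a4, a5] using this.symm
  obtain ⟨a, ha⟩ : ∃ a, a = r * (s * (r⁻¹ * s)) := ⟨_, rfl⟩
  obtain ⟨b, hb⟩ : ∃ b, b = r⁻¹ * (s * (r⁻¹ * (s * r⁻¹))) := ⟨_, rfl⟩
  have hra : r * a * r⁻¹ = b := by simp [ha, hb, mul_assoc, a3]
  have hrb : r * b * r⁻¹ = a⁻¹ * b⁻¹ := by
    simp [ha, hb, mul_assoc, hs', a1, a2, a3, a4, a5]
  have hsa : s * a * s⁻¹ = a⁻¹ := by simp [ha, mul_assoc, hs', hs]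
  have hsb : s * b * s⁻¹ = b⁻¹ := by simp [hb, mul_assoc, hs', e1]
  have hab : Commute a b := by
    have h1 : s * (r * b * r⁻¹) * s⁻¹ = (r * b * r⁻¹)⁻¹ := by
      simp [hb, mul_assoc, hs', a1, a2, a3, a4, a5]
    have h2 : s * (a⁻¹ * b⁻¹) * s⁻¹ = (s * a * s⁻¹)⁻¹ * (s * b * s⁻¹)⁻¹ := by group
    rw [hrb, h2, hsa, hsb] at h1
    simp only [inv_inv, mul_inv_rev] at h1
    exact h1
  have hN : (Subgroup.closure {a, b}).Normal := by
    have ha' : a ∈ Subgroup.closure {a, b} := Subgroup.subset_closure (by simp)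
    have hb' : b ∈ Subgroup.closure {a, b} := Subgroup.subset_closure (by simp)
    refine normal_closure_of_conj_mem hrs ?_
    rintro t (rfl | rfl) x (rfl | rfl)
    · rwa [hra]
    · rw [hrb]; exact mul_mem (inv_mem ha') (inv_mem hb')
    · rw [hsa]; exact inv_mem ha'
    · rw [hsb]; exact inv_mem hb'
  have := isSimpleGroup_psl hp
  rcases hN.eq_bot_or_eq_top with hN | hN
  · have ha1 : a ∈ Subgroup.closure {a, b} := Subgroup.subset_closure (by simp)
    rw [hN, Subgroup.mem_bot] at ha1
    refine not_commute_of_closure_eq_top hp hrs ?_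
    have := congrArg (fun z => z * s * r) (ha.symm.trans ha1)
    exact (by simpa [mul_assoc, hs] using this : r * s = s * r)
  · exact not_commute_of_closure_eq_top hp hN hab

end SmallOrbits

/-! ### Automorphisms of `PSL(2,p)`. -/

section ProjectiveLinearAutomorphisms

variable {p : ℕ} [Fact p.Prime]

/-- Conjugation of `SL(2, p)` by an element of `GL(2, p)`. -/
def conjSL (h : GL (Fin 2) (ZMod p)) : MulAut SL(2, ZMod p) where
  toFun A := ⟨h.1 * A.1 * h⁻¹.1, by
    have : (h.1 * h⁻¹.1).det = 1 := by simp
    rw [Matrix.det_mul] at this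
    rw [Matrix.det_mul, Matrix.det_mul, A.2, mul_one, this]⟩
  invFun A := ⟨h⁻¹.1 * A.1 * h.1, by
    have : (h⁻¹.1 * h.1).det = 1 := by simp
    rw [Matrix.det_mul] at this
    rw [Matrix.det_mul, Matrix.det_mul, A.2, mul_one, this]⟩
  left_inv A := by
    apply Subtype.ext
    change h⁻¹.1 * (h.1 * A.1 * h⁻¹.1) * h.1 = A.1
    rw [mul_assoc, mul_assoc, mul_assoc, Units.inv_mul, mul_one, ← mul_assoc, Units.inv_mul,
      one_mul]
  right_inv A := by
    apply Subtype.ext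
    change h.1 * (h⁻¹.1 * A.1 * h.1) * h⁻¹.1 = A.1
    rw [mul_assoc, mul_assoc, mul_assoc, Units.mul_inv, mul_one, ← mul_assoc, Units.mul_inv,
      one_mul]
  map_mul' A B := by
    apply Subtype.ext
    change h.1 * (A.1 * B.1) * h⁻¹.1 = h.1 * A.1 * h⁻¹.1 * (h.1 * B.1 * h⁻¹.1)
    simp only [mul_assoc, Units.inv_mul_cancel_left]

/-- The action of `GL(2, p)` on `PSL(2, p)` by conjugation. -/
def conjGL : GL (Fin 2) (ZMod p) →* MulAut PSL(2, ZMod p) :=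
  MonoidHom.mk' (fun h => QuotientGroup.congr _ _ (conjSL h)
      (Subgroup.characteristic_iff_map_eq.1 inferInstance (conjSL h))) <| by
    intro h k
    ext g
    induction g using QuotientGroup.induction_on with
    | H A =>
      change (QuotientGroup.mk (conjSL (h * k) A) : PSL(2, ZMod p)) =
        QuotientGroup.mk (conjSL h (conjSL k A))
      congr 1
      apply Subtype.ext
      change (h * k).1 * A.1 * (h * k)⁻¹.1 = h.1 * (k.1 * A.1 * k⁻¹.1) * h⁻¹.1
      rw [mul_inv_rev, Units.val_mul, Units.val_mul]
      simp only [mul_assoc]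

theorem det_conj (h : GL (Fin 2) (ZMod p)) {A : Matrix (Fin 2) (Fin 2) (ZMod p)}
    (hA : A.det = 1) : (h.1 * A * h⁻¹.1).det = 1 :=
  (conjSL h (slMk p A hA)).2

theorem conjGL_pslMk (h : GL (Fin 2) (ZMod p)) (A : Matrix (Fin 2) (Fin 2) (ZMod p))
    (hA : A.det = 1) : conjGL h (pslMk p A hA) = pslMk p (h.1 * A * h⁻¹.1) (det_conj h hA) := rfl

theorem conjGL_pslMk_eq_iff (h : GL (Fin 2) (ZMod p)) (A B : Matrix (Fin 2) (Fin 2) (ZMod p))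
    (hA : A.det = 1) (hB : B.det = 1) :
    conjGL h (pslMk p A hA) = pslMk p B hB ↔ h.1 * A = B * h.1 ∨ h.1 * A = -(B * h.1) := by
  rw [conjGL_pslMk, pslMk_eq_iff]
  constructor
  · rintro (h1 | h1)
    · left; rw [← h1, Units.inv_mul_cancel_right]
    · right; rw [← neg_mul, ← h1, Units.inv_mul_cancel_right]
  · rintro (h1 | h1)
    · left; rw [h1, Units.mul_inv_cancel_right]
    · right; rw [h1, ← neg_mul, Units.mul_inv_cancel_right]

theorem exists_GL_of_det_ne_zero (A : Matrix (Fin 2) (Fin 2) (ZMod p)) (hA : A.det ≠ 0) :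
    ∃ h : GL (Fin 2) (ZMod p), h.1 = A :=
  ⟨Matrix.GeneralLinearGroup.mkOfDetNeZero A hA, rfl⟩

theorem exists_conjGL_eq (T A B : Matrix (Fin 2) (Fin 2) (ZMod p)) (hT : T.det ≠ 0)
    (hA : A.det = 1) (hB : B.det = 1) (h : T * A = B * T) :
    ∃ k : GL (Fin 2) (ZMod p), k.1 = T ∧ conjGL k (pslMk p A hA) = pslMk p B hB := by
  obtain ⟨k, rfl⟩ := exists_GL_of_det_ne_zero T hT
  exact ⟨k, rfl, (conjGL_pslMk_eq_iff _ _ _ _ _).2 (Or.inl h)⟩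

theorem exists_fin_two (A : Matrix (Fin 2) (Fin 2) (ZMod p)) :
    ∃ a b c d, A = !![a, b; c, d] := ⟨_, _, _, _, Matrix.eta_fin_two A⟩

theorem fin_two_ext {a b c d a' b' c' d' : ZMod p} :
    (!![a, b; c, d] : Matrix (Fin 2) (Fin 2) (ZMod p)) = !![a', b'; c', d'] ↔
      a = a' ∧ b = b' ∧ c = c' ∧ d = d' := by
  constructor
  · intro h
    exact ⟨congrFun (congrFun h 0) 0, congrFun (congrFun h 0) 1, congrFun (congrFun h 1) 0,
      congrFun (congrFun h 1) 1⟩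
  · rintro ⟨rfl, rfl, rfl, rfl⟩; rfl

theorem neg_fin_two (a b c d : ZMod p) :
    -(!![a, b; c, d] : Matrix (Fin 2) (Fin 2) (ZMod p)) = !![-a, -b; -c, -d] := by
  ext i j; fin_cases i <;> fin_cases j <;> rfl

theorem one_fin_two :
    (1 : Matrix (Fin 2) (Fin 2) (ZMod p)) = !![1, 0; 0, 1] := Matrix.one_fin_two

/-- Conjugation by an invertible matrix is trivial on `PSL(2, p)` only for scalar matrices. -/
theorem exists_scalar_of_conjGL_eq_one (hp : 5 ≤ p) {h : GL (Fin 2) (ZMod p)}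
    (hh : conjGL h = 1) : ∃ m : ZMod p, h.1 = !![m, 0; 0, m] := by
  have h2 := two_ne_zero_zmod hp
  have hdet : h.1.det ≠ 0 := Matrix.GeneralLinearGroup.det_ne_zero h
  have hU : conjGL h (upperUni p 1) = upperUni p 1 := by rw [hh]; rfl
  have hV : conjGL h (lowerUni p 1) = lowerUni p 1 := by rw [hh]; rfl
  unfold upperUni at hU
  unfold lowerUni at hV
  rw [conjGL_pslMk_eq_iff] at hU hV
  obtain ⟨a, b, c, d, habcd⟩ := exists_fin_two h.1
  rw [habcd] at hU hV hdet ⊢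
  rw [Matrix.det_fin_two_of] at hdet
  simp only [Matrix.mul_fin_two, neg_fin_two, fin_two_ext] at hU hV ⊢
  have hc : c = 0 := by
    rcases hU with h | h
    · linear_combination -h.1
    · exact (mul_eq_zero.1 (by linear_combination h.2.2.1 : 2 * c = 0)).resolve_left h2
  subst hc
  have had : a = d := by
    rcases hU with h | h
    · linear_combination h.2.1
    · have : 2 * a = 0 := by linear_combination h.1
      simp [(mul_eq_zero.1 this).resolve_left h2] at hdet
  have hb : b = 0 := by
    rcases hV with h | h
    · linear_combination h.1
    · exact (mul_eq_zero.1 (by linear_combination h.2.1 : 2 * b = 0)).resolve_left h2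
  exact ⟨d, had, hb, rfl, rfl⟩

/-- As `p` is odd, the sign of a lift `A` can be chosen with `A ^ p = 1`. Then `(A - 1) ^ p = 0` in
characteristic `p`, so `A - 1` has zero trace and determinant. -/
theorem exists_nilpotent_of_pow_eq_one (hp : 5 ≤ p) {g : PSL(2, ZMod p)} (hg : g ^ p = 1) :
    ∃ (a b c : ZMod p) (h : _), a ^ 2 + b * c = 0 ∧ g = pslMk p !![1 + a, b; c, 1 - a] h := by
  have hodd : Odd p := (Fact.out : p.Prime).odd_of_ne_two (by omega)
  obtain ⟨A, hA, hAp, rfl⟩ : ∃ A : Matrix (Fin 2) (Fin 2) (ZMod p), ∃ hA : A.det = 1, A ^ p = 1 ∧ g = pslMk p A hA := by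
    obtain ⟨A, hA, rfl⟩ := exists_eq_pslMk g
    rw [pslMk_pow, pslMk_eq_one_iff] at hg
    rcases hg with hg | hg
    · exact ⟨A, hA, hg, rfl⟩
    · exact ⟨-A, det_neg_two hA, by rw [hodd.neg_pow, hg, neg_neg], pslMk_neg A hA⟩
  have hnil : (A - 1) ^ p = 0 := by
    rw [sub_pow_char_of_commute _ (Commute.one_right A), hAp, one_pow, sub_self]
  have hdet : (A - 1).det = 0 := by
    have := congrArg Matrix.det hnil
    rw [Matrix.det_pow, Matrix.det_zero] at this
    exact pow_eq_zero_iff (Fact.out : p.Prime).ne_zero |>.1 this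
  have htr : (A - 1).trace = 0 :=
    (Matrix.isNilpotent_trace_of_isNilpotent ⟨p, hnil⟩).eq_zero
  obtain ⟨a, b, c, d, rfl⟩ := exists_fin_two A
  simp only [Matrix.trace_fin_two, Matrix.det_fin_two, Matrix.sub_apply, Matrix.one_apply] at hdet htr
  simp at hdet htr
  have hd : d = 1 - (a - 1) := by linear_combination htr
  subst hd
  have ha : (1 : ZMod p) + (a - 1) = a := by ring
  exact ⟨a - 1, b, c, by rw [ha]; exact hA, by linear_combination -hdet, by simp only [ha]⟩

theorem exists_conjGL_upperUni (hp : 5 ≤ p) {g : PSL(2, ZMod p)} (hg : g ^ p = 1) (hg1 : g ≠ 1) :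
    ∃ k : GL (Fin 2) (ZMod p), conjGL k (upperUni p 1) = g := by
  obtain ⟨a, b, c, hdet, habc, rfl⟩ := exists_nilpotent_of_pow_eq_one hp hg
  by_cases hc : c = 0
  · subst hc
    have ha : a = 0 := by simpa using habc
    subst ha
    have hb : b ≠ 0 := by
      rintro rfl
      exact hg1 ((pslMk_eq_one_iff _ _).2 (Or.inl (by simp [one_fin_two])))
    obtain ⟨k, -, hk⟩ := exists_conjGL_eq !![b, 0; 0, 1] _ _ (by simpa using hb)
      (by simp [Matrix.det_fin_two] : (!![1, 1; 0, 1] : Matrix _ _ (ZMod p)).det = 1) hdet (by simp)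
    exact ⟨k, hk⟩
  -- The columns are `N e₁` and `e₁`, a Jordan basis for the nilpotent part `N`.
  · obtain ⟨k, -, hk⟩ := exists_conjGL_eq !![a, 1; c, 0] _ _ (by simpa using hc)
      (by simp [Matrix.det_fin_two] : (!![1, 1; 0, 1] : Matrix _ _ (ZMod p)).det = 1) hdet (by
        simp only [Matrix.mul_fin_two, fin_two_ext]
        refine ⟨?_, ?_, ?_, ?_⟩
        · linear_combination -habc
        all_goals ring)
    exact ⟨k, hk⟩

theorem upperUni_pow_card (x : ZMod p) : upperUni p x ^ p = 1 := by
  rw [upperUni_pow]; simp [upperUni_zero]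

theorem lowerUni_pow_card (x : ZMod p) : lowerUni p x ^ p = 1 := by
  rw [lowerUni_pow]; simp [lowerUni_zero]

theorem conjGL_upperUni {k : GL (Fin 2) (ZMod p)} {y : ZMod p} (hk : k.1 = !![1, y; 0, 1])
    (x : ZMod p) : conjGL k (upperUni p x) = upperUni p x := by
  unfold upperUni
  rw [conjGL_pslMk_eq_iff, hk]
  left
  simp only [Matrix.mul_fin_two, fin_two_ext]
  refine ⟨?_, ?_, ?_, ?_⟩ <;> simp [add_comm]

/-- Every automorphism of `PSL(2, p)` is induced by an element of `GL(2, p)`. -/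
theorem conjGL_surjective (hp : 5 ≤ p) (f : MulAut PSL(2, ZMod p)) : ∃ k, conjGL k = f := by
  have h2 := two_ne_zero_zmod hp
  have hU1 : upperUni p 1 ≠ 1 := fun h =>
    not_commute_upperUni_lowerUni hp one_ne_zero one_ne_zero (h ▸ Commute.one_left (lowerUni p 1))
  have hV1 : lowerUni p 1 ≠ 1 := fun h =>
    not_commute_upperUni_lowerUni hp one_ne_zero one_ne_zero (h ▸ Commute.one_right (upperUni p 1))
  obtain ⟨k, hk⟩ := exists_conjGL_upperUni hp (g := f (upperUni p 1))
    (by rw [← map_pow, upperUni_pow_card, map_one]) (by simpa using hU1)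
  obtain ⟨f₁, hf₁⟩ : ∃ f₁, f₁ = (conjGL k)⁻¹ * f := ⟨_, rfl⟩
  have hf₁U : f₁ (upperUni p 1) = upperUni p 1 := by
    rw [hf₁, MulAut.mul_apply, ← hk, MulAut.inv_apply_self]
  obtain ⟨a, b, c, hdet, habc, hV⟩ := exists_nilpotent_of_pow_eq_one hp (g := f₁ (lowerUni p 1))
    (by rw [← map_pow, lowerUni_pow_card, map_one])
  have hc : c ≠ 0 := by
    rintro rfl
    have ha : a = 0 := by simpa using habc
    subst ha
    have : f₁ (lowerUni p 1) = upperUni p b := by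
      rw [hV, upperUni]; simp only [add_zero, sub_zero]
    have hcomm : Commute (f₁ (upperUni p 1)) (f₁ (lowerUni p 1)) := by
      rw [hf₁U, this]
      change _ * _ = _ * _
      rw [← upperUni_add, ← upperUni_add, add_comm]
    refine not_commute_upperUni_lowerUni hp one_ne_zero one_ne_zero (f₁.injective ?_)
    rw [map_mul, map_mul]
    exact hcomm
  -- A unitriangular conjugation keeps `upperUni p 1` and makes the second image lower
  -- unitriangular.
  obtain ⟨t, htU, ht⟩ := exists_conjGL_eq !![1, -(a / c); 0, 1] _ !![1, 0; c, 1] (by simp)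
    hdet (by simp) (by
      simp only [Matrix.mul_fin_two, fin_two_ext]
      refine ⟨?_, ?_, ?_, ?_⟩ <;> field_simp <;> first | ring1 | linear_combination habc)
  obtain ⟨f₂, hf₂⟩ : ∃ f₂, f₂ = conjGL t * f₁ := ⟨_, rfl⟩
  have hf₂U : f₂ (upperUni p 1) = upperUni p 1 := by
    rw [hf₂, MulAut.mul_apply, hf₁U, conjGL_upperUni htU]
  have hf₂V : f₂ (lowerUni p 1) = lowerUni p c := by
    rw [hf₂, MulAut.mul_apply, hV, ht]; rfl
  have hc1 : c = 1 := by
    -- This Weyl element relation pins down the last parameter: its image under `f₂` forces `c = 1`.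
    have hinv : (upperUni p 1 * (lowerUni p 1)⁻¹ * upperUni p 1) ^ 2 = 1 := by
      rw [← lowerUni_neg]
      simp only [upperUni, lowerUni, pslMk_mul, pslMk_pow]
      rw [pslMk_eq_one_iff, one_fin_two]
      right
      simp only [pow_two, Matrix.mul_fin_two, neg_fin_two, fin_two_ext]
      refine ⟨?_, ?_, ?_, ?_⟩ <;> ring
    have himg := congrArg f₂ hinv
    rw [map_pow, map_mul, map_mul, map_inv, hf₂U, hf₂V, map_one, ← lowerUni_neg] at himg
    simp only [upperUni, lowerUni, pslMk_mul, pslMk_pow] at himg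
    rw [pslMk_eq_one_iff, one_fin_two] at himg
    simp only [pow_two, Matrix.mul_fin_two, neg_fin_two, fin_two_ext] at himg
    have h3 : 2 * (c * (1 - c)) = 0 := by
      rcases himg with h | h
      · linear_combination -h.2.2.1
      · linear_combination -h.2.2.1
    have := (mul_eq_zero.1 ((mul_eq_zero.1 h3).resolve_left h2)).resolve_left hc
    linear_combination -this
  have hf₂1 : f₂ = 1 := by
    have htop : MonoidHom.eqLocus f₂.toMonoidHom (MonoidHom.id _) = ⊤ :=
      eq_top_of_uni_mem one_ne_zero one_ne_zero (x := 1) (y := 1) hf₂U (by rw [hc1] at hf₂V; exact hf₂V)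
    ext g
    exact (htop ▸ Subgroup.mem_top g : g ∈ MonoidHom.eqLocus f₂.toMonoidHom (MonoidHom.id _))
  refine ⟨k * t⁻¹, ?_⟩
  rw [map_mul, map_inv]
  rw [hf₂, hf₁] at hf₂1
  rw [eq_inv_of_mul_eq_one_left hf₂1]
  group

/-- Automorphisms of odd order of `PSL(2, p)` are inner. -/
theorem exists_conj_eq_of_odd (hp : 5 ≤ p) {f : MulAut PSL(2, ZMod p)} {n : ℕ} (hn : Odd n)
    (hf : f ^ n = 1) : ∃ r : PSL(2, ZMod p), r ^ n = 1 ∧ MulAut.conj r = f := by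
  obtain ⟨k, rfl⟩ := conjGL_surjective hp f
  obtain ⟨m, hm⟩ := exists_scalar_of_conjGL_eq_one hp (h := k ^ n) (by rw [map_pow, hf])
  obtain ⟨j, rfl⟩ := hn
  have hd : k.1.det ≠ 0 := Matrix.GeneralLinearGroup.det_ne_zero k
  -- An odd power of `det k` is a square, hence so is `det k`, and `k` can be rescaled to
  -- determinant `1`.
  have hdet : k.1.det ^ (2 * j + 1) = m ^ 2 := by
    rw [← Matrix.det_pow, ← Units.val_pow_eq_pow_val, hm, Matrix.det_fin_two_of]; ring
  obtain ⟨q, hq⟩ : ∃ q : ZMod p, q ^ 2 * k.1.det = 1 :=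
    ⟨k.1.det ^ j / m, by
      have hm0 : m ^ 2 ≠ 0 := hdet ▸ pow_ne_zero _ hd
      rw [div_pow, div_mul_eq_mul_div, div_eq_one_iff_eq hm0, ← hdet]; ring⟩
  have hA : (q • k.1).det = 1 := by
    rw [Matrix.det_smul, Fintype.card_fin]; exact hq
  have hconj : MulAut.conj (pslMk p (q • k.1) hA) = conjGL k := by
    ext g
    obtain ⟨B, hB, rfl⟩ := exists_eq_pslMk g
    rw [conjGL_pslMk, MulAut.conj_apply, mul_inv_eq_iff_eq_mul, pslMk_mul, pslMk_mul, pslMk_eq_iff]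
    left
    rw [Matrix.mul_smul, Units.inv_mul_cancel_right, Matrix.smul_mul]
  refine ⟨_, ?_, hconj⟩
  refine eq_one_of_commute_all hp fun g => ?_
  have h1 : MulAut.conj (pslMk p (q • k.1) hA ^ (2 * j + 1)) g = g := by
    rw [map_pow, hconj, hf]; rfl
  rw [MulAut.conj_apply, mul_inv_eq_iff_eq_mul] at h1
  exact h1.symm

end ProjectiveLinearAutomorphisms

/-! ### From balanced regular Cayley maps to generating pairs. -/

theorem OrientedMap.Isomorphic.symm {M N : OrientedMap} (h : M.Isomorphic N) :
    N.Isomorphic M := by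
  obtain ⟨f⟩ := h
  refine ⟨⟨f.toEquiv.symm, fun d => ?_, fun d => ?_⟩⟩
  · rw [Equiv.symm_apply_eq, f.map_rot, Equiv.apply_symm_apply]
  · rw [Equiv.symm_apply_eq, f.map_rev, Equiv.apply_symm_apply]

/-- The skew-product group modulo a normal `L_G` is commutative. -/
theorem commute_skewProduct_quotient {G : Type} [Group G] {σ : Equiv.Perm G}
    [hN : ((leftRegular G).subgroupOf (skewProduct σ)).Normal]
    (a b : skewProduct σ ⧸ (leftRegular G).subgroupOf (skewProduct σ)) : Commute a b := by
  have hσ : σ ∈ skewProduct σ :=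
    (le_sup_right : Subgroup.zpowers σ ≤ _) (Subgroup.mem_zpowers σ)
  let q := QuotientGroup.mk' ((leftRegular G).subgroupOf (skewProduct σ))
  -- The quotient is cyclic, generated by the image of `σ`: the preimage of that cyclic group
  -- contains `L_G` and `σ`.
  let K : Subgroup (skewProduct σ) := (Subgroup.zpowers (q ⟨σ, hσ⟩)).comap q
  have hK : skewProduct σ ≤ K.map (skewProduct σ).subtype := by
    refine sup_le ?_ ?_
    · intro g hg
      have hg' : g ∈ skewProduct σ := (le_sup_left : leftRegular G ≤ _) hg
      refine ⟨⟨g, hg'⟩, ?_, rfl⟩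
      change q ⟨g, hg'⟩ ∈ Subgroup.zpowers (q ⟨σ, hσ⟩)
      have : q ⟨g, hg'⟩ = 1 :=
        (QuotientGroup.eq_one_iff _).2 (Subgroup.mem_subgroupOf.2 hg)
      rw [this]
      exact Subgroup.one_mem _
    · rw [Subgroup.zpowers_le]
      exact ⟨⟨σ, hσ⟩, Subgroup.mem_zpowers _, rfl⟩
  have hall : ∀ a : skewProduct σ ⧸ (leftRegular G).subgroupOf (skewProduct σ),
      a ∈ Subgroup.zpowers (q ⟨σ, hσ⟩) := by
    intro a
    obtain ⟨x, rfl⟩ := QuotientGroup.mk'_surjective _ a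
    obtain ⟨y, hy, hyx⟩ := hK x.2
    have : y = x := Subtype.ext hyx
    exact this ▸ hy
  obtain ⟨m, rfl⟩ := hall a
  obtain ⟨n, rfl⟩ := hall b
  exact Commute.zpow_zpow (Commute.refl _) m n

namespace CayleyMap

section General

variable {G : Type} [Group G] (M : CayleyMap G)

/-- Left translations as automorphisms of a Cayley map. -/
def leftAut : G →* M.toMap.Aut where
  toFun g := ⟨(Equiv.prodCongr (Equiv.mulLeft g) (Equiv.refl M.S) : Equiv.Perm (G × M.S)), by
    rintro f (rfl | rfl)
    · rfl
    · ext1 d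
      exact Prod.ext (mul_assoc g d.1 d.2) rfl⟩
  map_one' := by
    apply Subtype.ext
    ext1 d
    exact Prod.ext (one_mul d.1) rfl
  map_mul' g h := by
    apply Subtype.ext
    ext1 d
    exact Prod.ext (mul_assoc g h d.1) rfl

theorem leftAut_apply (g h : G) (x : M.S) : (M.leftAut g).1 ((h, x) : G × M.S) = (g * h, x) := rfl

variable {M}

theorem leftAut_injective (x : M.S) : Function.Injective M.leftAut := by
  intro g h hgh
  have : (M.leftAut g).1 ((1, x) : G × M.S) = (M.leftAut h).1 ((1, x) : G × M.S) := by rw [hgh]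
  rw [leftAut_apply, leftAut_apply] at this
  simpa using congrArg Prod.fst this

/-- For a balanced Cayley map on a finite perfect group, left translations form a normal
subgroup of the automorphism group. -/
theorem IsBalanced.normal_range_leftAut [Finite G]
    (hG : ∀ {Q : Type} [Group Q], (∀ a b : Q, Commute a b) → ∀ (f : G →* Q) g, f g = 1)
    (hbal : M.IsBalanced) (x : M.S) : M.leftAut.range.Normal := by
  obtain ⟨σ, -, hN, ⟨e⟩⟩ := hbal
  have hN' : ((leftRegular G).subgroupOf (skewProduct σ)).Normal := hN
  have hle : (M.leftAut.range.map e.toMonoidHom) ≤ (leftRegular G).subgroupOf (skewProduct σ) := by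
    rintro _ ⟨_, ⟨g, rfl⟩, rfl⟩
    exact (QuotientGroup.eq_one_iff _).1
      (hG commute_skewProduct_quotient
        ((QuotientGroup.mk' ((leftRegular G).subgroupOf (skewProduct σ))).comp
          (e.toMonoidHom.comp M.leftAut)) g)
  have hcard : Nat.card ((leftRegular G).subgroupOf (skewProduct σ)) ≤
      Nat.card (M.leftAut.range.map e.toMonoidHom) := by
    rw [Subgroup.card_map_of_injective e.injective,
      ← Nat.card_congr (MonoidHom.ofInjective (leftAut_injective x)).toEquiv,
      Nat.card_congr (Subgroup.subgroupOfEquivOfLe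
        (show leftRegular G ≤ skewProduct σ from le_sup_left)).toEquiv]
    exact Nat.card_le_card_of_surjective _ (MonoidHom.rangeRestrict_surjective _)
  have heq := Subgroup.eq_of_le_of_card_ge hle hcard
  have : M.leftAut.range = ((leftRegular G).subgroupOf (skewProduct σ)).comap e.toMonoidHom := by
    rw [← heq, Subgroup.comap_map_eq_self_of_injective e.injective]
  rw [this]
  infer_instance

/-- If left translations form a normal subgroup of the automorphism group of a regular Cayley
map, then the cyclic permutation of the generating set extends to a group automorphism. -/
theorem exists_mulAut_eq_P (hreg : M.IsRegular) (x : M.S)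
    (hnorm : M.leftAut.range.Normal) : ∃ τ : MulAut G, ∀ y : M.S, τ y = M.P y := by
  obtain ⟨f, hf, hfx⟩ := hreg ((1, x) : G × M.S) ((1, M.P x) : G × M.S)
  have hrot : ∀ d, f (M.toMap.rot d) = M.toMap.rot (f d) := fun d =>
    (DFunLike.congr_fun (hf M.toMap.rot (by simp)) d).symm
  have hrev : ∀ d, f (M.toMap.rev d) = M.toMap.rev (f d) := fun d =>
    (DFunLike.congr_fun (hf M.toMap.rev (by simp)) d).symm
  -- Since `f` commutes with the rotation and `P` is transitive, one dart at `1` determines `f` on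
  -- all of them.
  have hone : ∀ y : M.S, f ((1, y) : G × M.S) = ((1, M.P y) : G × M.S) := by
    intro y
    have : Finite M.S := inferInstance
    obtain ⟨k, -, -, rfl⟩ :=
      (M.isCycleOn.2 (Set.mem_univ x) (Set.mem_univ y)).exists_pow_eq''
    clear * - hrot hfx
    induction k with
    | zero => exact hfx
    | succ k ih =>
      rw [pow_succ', Equiv.Perm.mul_apply]
      have := hrot ((1, (M.P ^ k) x) : G × M.S)
      rw [ih] at this
      exact this
  let e := MonoidHom.ofInjective (leftAut_injective x)
  let τ : MulAut G := (e.trans (MulAut.conjNormal (⟨f, hf⟩ : M.toMap.Aut))).trans e.symm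
  have hτ : ∀ g, M.leftAut (τ g) * ⟨f, hf⟩ = ⟨f, hf⟩ * M.leftAut g := by
    intro g
    have h1 : e (τ g) = MulAut.conjNormal (⟨f, hf⟩ : M.toMap.Aut) (e g) := e.apply_symm_apply _
    have h2 := congrArg Subtype.val h1
    rw [MulAut.conjNormal_apply] at h2
    exact (eq_mul_inv_iff_mul_eq.1 h2)
  have hfg : ∀ g (y : M.S), f ((g, y) : G × M.S) = ((τ g, M.P y) : G × M.S) := by
    intro g y
    have h1 := congrArg (fun a : M.toMap.Aut => a.1 ((1, y) : G × M.S)) (hτ g)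
    change (M.leftAut (τ g)).1 (f ((1, y) : G × M.S)) = f ((M.leftAut g).1 ((1, y) : G × M.S)) at h1
    rw [hone, leftAut_apply, leftAut_apply, mul_one, mul_one] at h1
    exact h1.symm
  refine ⟨τ, fun y => ?_⟩
  -- Reversing the dart `(1, y)` gives a dart starting at `y`. Comparing initial vertices yields `τ
  -- y = P y`.
  have h1 : f (M.toMap.rev ((1, y) : G × M.S)) = M.toMap.rev (f ((1, y) : G × M.S)) := hrev _
  rw [hone] at h1
  have h2 : f ((1 * (y : G), ⟨(y : G)⁻¹, M.inv_mem _ y.2⟩) : G × M.S) =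
    ((1 * (M.P y : G), ⟨(M.P y : G)⁻¹, M.inv_mem _ (M.P y).2⟩) : G × M.S) := h1
  rw [hfg] at h2
  simpa using congrArg Prod.fst h2

variable {τ : MulAut G}

theorem zpow_apply_eq (hτ : ∀ y : M.S, τ y = M.P y) (k : ℤ) (y : M.S) : (τ ^ k) y = ((M.P ^ k) y : M.S) := by
  have hinv : ∀ y : M.S, τ⁻¹ y = (M.P⁻¹ y : M.S) := fun y => by
    rw [MulAut.inv_apply, MulEquiv.symm_apply_eq, hτ, Equiv.Perm.inv_def,
      Equiv.apply_symm_apply]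
  induction k generalizing y with
  | zero => rfl
  | succ k ih =>
    rw [zpow_add_one, zpow_add_one, MulAut.mul_apply, hτ, ih]; rfl
  | pred k ih =>
    rw [zpow_sub_one, zpow_sub_one, MulAut.mul_apply, hinv, ih]; rfl

theorem exists_zpow_apply_eq (hτ : ∀ y : M.S, τ y = M.P y) (x y : M.S) : ∃ k : ℤ, (τ ^ k) x = (y : G) := by
  obtain ⟨k, hk⟩ := M.isCycleOn.2 (Set.mem_univ x) (Set.mem_univ y)
  exact ⟨k, by rw [zpow_apply_eq hτ, hk]⟩

theorem mulAut_eq_one_of_forall {f : MulAut G} (hf : ∀ y : M.S, f y = y) : f = 1 := by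
  have htop : MonoidHom.eqLocus f.toMonoidHom (MonoidHom.id G) = ⊤ := by
    rw [eq_top_iff, ← M.closure_eq_top, Subgroup.closure_le]
    exact fun y hy => hf ⟨y, hy⟩
  ext g
  exact (htop ▸ Subgroup.mem_top g : g ∈ MonoidHom.eqLocus f.toMonoidHom (MonoidHom.id G))

/-- Powers of `τ` commute and are transitive on `S`, so one fixed point makes all of the generating
set fixed. -/
theorem zpow_eq_one_of_apply_eq (hτ : ∀ y : M.S, τ y = M.P y) {x : M.S} {k : ℤ} (h : (τ ^ k) x = (x : G)) : τ ^ k = 1 := by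
  refine mulAut_eq_one_of_forall (M := M) fun y => ?_
  obtain ⟨m, hm⟩ := exists_zpow_apply_eq hτ x y
  rw [← hm, ← MulAut.mul_apply, ← zpow_add, add_comm, zpow_add, MulAut.mul_apply, h]

/-- A dart `(a, z)` of the algebraic map corresponds to `(φ⁻¹ a, φ⁻¹ (z s))`. This is bijective
because the powers of `τ` act regularly on `S`. -/
theorem isomorphic_innMap (hτ : ∀ y : M.S, τ y = M.P y) (x : M.S) {r s : G} (hs : s * s = 1) (hs1 : s ≠ 1) (φ : MulAut G)
    (hφ : MulAut.conj r = φ * τ * φ⁻¹) (hx : φ x = s) :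
    M.toMap.Isomorphic (innMap G r s hs hs1) := by
  have hz : ∀ z : Subgroup.zpowers (MulAut.conj r), ∃ k : ℤ,
      z.1 = φ * τ ^ k * φ⁻¹ ∧ φ⁻¹ (z.1 s) = (τ ^ k) x := by
    rintro ⟨_, k, rfl⟩
    have : MulAut.conj r ^ k = φ * τ ^ k * φ⁻¹ := by rw [hφ, conj_zpow]
    refine ⟨k, this, ?_⟩
    change φ⁻¹ ((MulAut.conj r ^ k) s) = _
    rw [this, ← hx]
    simp [MulAut.mul_apply]
  have hmem : ∀ z : Subgroup.zpowers (MulAut.conj r), φ⁻¹ (z.1 s) ∈ M.S := by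
    intro z
    obtain ⟨k, -, hk⟩ := hz z
    rw [hk, zpow_apply_eq hτ]
    exact Subtype.prop _
  let F : InnSemidirect G r → G × M.S := fun d => (φ⁻¹ d.left, ⟨φ⁻¹ (d.right.1 s), hmem d.right⟩)
  have hFinj : Function.Injective F := by
    rintro ⟨a, z⟩ ⟨b, w⟩ h
    have h1 : a = b := φ⁻¹.injective (congrArg Prod.fst h)
    have h2 : φ⁻¹ (z.1 s) = φ⁻¹ (w.1 s) := congrArg (fun d : G × M.S => (d.2 : G)) h
    have h3 : z = w := by
      obtain ⟨k, hk, hk'⟩ := hz z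
      obtain ⟨m, hm, hm'⟩ := hz w
      rw [hk', hm'] at h2
      have h4 : (τ ^ (-m + k)) x = (x : G) := by
        rw [zpow_add, MulAut.mul_apply, h2, ← MulAut.mul_apply, ← zpow_add]; simp
      have h5 : τ ^ k = τ ^ m := by
        have := zpow_eq_one_of_apply_eq hτ h4
        rw [zpow_add, zpow_neg, inv_mul_eq_one] at this
        exact this.symm
      exact Subtype.ext (by rw [hk, hm, h5])
    rw [h1, h3]
  have hFsurj : Function.Surjective F := by
    rintro ⟨g, y⟩
    obtain ⟨k, hk⟩ := exists_zpow_apply_eq hτ x y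
    refine ⟨⟨φ g, ⟨MulAut.conj r ^ k, k, rfl⟩⟩, Prod.ext (φ.symm_apply_apply g) (Subtype.ext ?_)⟩
    change φ⁻¹ ((MulAut.conj r ^ k) s) = y
    rw [hφ, conj_zpow, ← hx, ← hk]
    simp [MulAut.mul_apply]
  refine OrientedMap.Isomorphic.symm ⟨⟨Equiv.ofBijective F ⟨hFinj, hFsurj⟩, ?_, ?_⟩⟩
  · rintro ⟨a, z⟩
    change F (⟨a, z⟩ * SemidirectProduct.inr ⟨MulAut.conj r, _⟩) =
      ((φ⁻¹ a, M.P ⟨φ⁻¹ (z.1 s), hmem z⟩) : G × M.S)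
    refine Prod.ext ?_ (Subtype.ext ?_)
    · simp [F]
    · rw [← hτ]
      change φ⁻¹ ((z.1 * MulAut.conj r) s) = τ (φ⁻¹ (z.1 s))
      obtain ⟨k, hk, hk'⟩ := hz z
      have hc : z.1 * MulAut.conj r = φ * τ * τ ^ k * φ⁻¹ := by
        rw [hk, hφ]
        have hc' : τ ^ k * τ = τ * τ ^ k := (Commute.refl τ).zpow_left k
        simp only [mul_assoc, inv_mul_cancel_left, ← hc']
      rw [hk', hc, ← hx]
      simp [MulAut.mul_apply]
  · rintro ⟨a, z⟩
    change F (⟨a, z⟩ * SemidirectProduct.inl s) =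
      ((φ⁻¹ a * φ⁻¹ (z.1 s), ⟨(φ⁻¹ (z.1 s))⁻¹, _⟩) : G × M.S)
    refine Prod.ext ?_ (Subtype.ext ?_)
    · simp [F]
    · change φ⁻¹ ((z.1 * 1) s) = (φ⁻¹ (z.1 s))⁻¹
      rw [mul_one, ← map_inv, ← map_inv, inv_eq_of_mul_eq_one_right hs]

/-- Inversion is an involutive permutation of a set of odd size, so it has a fixed point. -/
theorem exists_mul_self_eq_one (hodd : Odd M.valency) : ∃ x : M.S, (x : G) * x = 1 := by
  let f : Equiv.Perm M.S :=
    ⟨fun y => ⟨(y : G)⁻¹, M.inv_mem _ y.2⟩, fun y => ⟨(y : G)⁻¹, M.inv_mem _ y.2⟩,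
      fun y => by simp, fun y => by simp⟩
  obtain ⟨x, hx⟩ := Equiv.Perm.exists_fixed_point_of_prime (p := 2) (n := 1) (σ := f)
    (by rw [Fintype.card_coe]; exact fun h => (Nat.not_even_iff_odd.2 hodd) (even_iff_two_dvd.2 h))
    (Equiv.ext fun y => Subtype.ext (inv_inv (y : G)))
  exact ⟨x, mul_eq_one_iff_eq_inv.2 (congrArg Subtype.val hx : (x : G)⁻¹ = x).symm⟩

end General

/-- The structure of balanced regular Cayley maps of odd valency on `PSL(2, p)`. -/
theorem exists_generators_of_isBalanced {p : ℕ} [Fact p.Prime] (hp : 5 ≤ p)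
    {M : CayleyMap PSL(2, ZMod p)} (hreg : M.IsRegular) (hbal : M.IsBalanced)
    (hodd : Odd M.valency) :
    ∃ r x : PSL(2, ZMod p), r ^ M.valency = 1 ∧ x * x = 1 ∧ Subgroup.closure {r, x} = ⊤ ∧
      ∀ (φ : MulAut PSL(2, ZMod p)) (r' s : PSL(2, ZMod p)) (hs : s * s = 1) (hs1 : s ≠ 1),
        φ r = r' → φ x = s → M.toMap.Isomorphic (innMap _ r' s hs hs1) := by
  obtain ⟨x, hx⟩ := exists_mul_self_eq_one hodd
  obtain ⟨τ, hτ⟩ := exists_mulAut_eq_P hreg x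
    (hbal.normal_range_leftAut (fun hQ f g => hom_eq_one_of_commute hp hQ f g) x)
  have hτn : τ ^ M.valency = 1 := by
    have hcyc : M.P.IsCycleOn (Finset.univ : Finset M.S) := by
      rw [Finset.coe_univ]; exact M.isCycleOn
    have h1 := hcyc.pow_card_apply (Finset.mem_univ x)
    rw [Finset.card_univ, Fintype.card_coe] at h1
    have h2 := zpow_eq_one_of_apply_eq hτ (x := x) (k := (M.valency : ℤ)) (by
      rw [zpow_apply_eq hτ, zpow_natCast]; exact congrArg Subtype.val h1)
    rwa [zpow_natCast] at h2
  obtain ⟨r, hr, hrτ⟩ := exists_conj_eq_of_odd hp hodd hτn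
  refine ⟨r, x, hr, hx, ?_, ?_⟩
  -- Every element of `S` is a conjugate of `x` by a power of `r`.
  · rw [eq_top_iff, ← M.closure_eq_top, Subgroup.closure_le]
    intro y hy
    obtain ⟨k, hk⟩ := exists_zpow_apply_eq hτ x ⟨y, hy⟩
    have hr' : r ∈ Subgroup.closure {r, (x : PSL(2, ZMod p))} := Subgroup.subset_closure (by simp)
    have hx' : (x : PSL(2, ZMod p)) ∈ Subgroup.closure {r, (x : PSL(2, ZMod p))} :=
      Subgroup.subset_closure (by simp)
    change (τ ^ k) x = y at hk
    rw [← hk, ← hrτ, ← map_zpow, MulAut.conj_apply]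
    exact mul_mem (mul_mem (zpow_mem hr' k) hx') (Subgroup.inv_mem _ (zpow_mem hr' k))
  · rintro φ _ _ hs hs1 rfl rfl
    refine isomorphic_innMap hτ x hs hs1 φ ?_ rfl
    rw [← hrτ]
    ext g
    simp [MulAut.mul_apply]

end CayleyMap

/-! ### Normal forms of generating pairs under `GL(2,p)`. -/

section NormalForms

variable {p : ℕ} [Fact p.Prime]

theorem mem_halfSystem_or_neg_mem (hp : Odd p) {x : ZMod p} (hx : x ≠ 0) :
    x ∈ halfSystem p ∨ -x ∈ halfSystem p := by
  obtain ⟨m, hm⟩ := hp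
  have h1 : x.val < p := ZMod.val_lt x
  have h2 : x.val ≠ 0 := (ZMod.val_ne_zero x).2 hx
  by_cases h : x.val ≤ (p - 1) / 2
  · exact Or.inl ⟨x.val, by omega, h, (ZMod.natCast_zmod_val x).symm⟩
  · refine Or.inr ⟨p - x.val, by omega, by omega, ?_⟩
    rw [Nat.cast_sub h1.le, ZMod.natCast_self, ZMod.natCast_zmod_val, zero_sub]

/-- Cayley–Hamilton, giving Chebyshev-type polynomials in the trace as coefficients. -/
theorem pow_succ_eq_of_pow_eq {B : Matrix (Fin 2) (Fin 2) (ZMod p)} (hB : B.det = 1) {n : ℕ}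
    {x y : ZMod p} (h : B ^ n = x • B + y • 1) :
    B ^ (n + 1) = (x * B.trace + y) • B + (-x) • 1 := by
  have hsq : B * B = B.trace • B + (-1 : ZMod p) • 1 := by
    obtain ⟨a, b, c, d, rfl⟩ := exists_fin_two B
    rw [Matrix.det_fin_two_of] at hB
    rw [one_fin_two]
    ext i j
    fin_cases i <;> fin_cases j <;> simp [Matrix.trace_fin_two] <;>
      first | ring1 | linear_combination -hB
  rw [pow_succ, h, add_mul, smul_mul_assoc, hsq, smul_mul_assoc, one_mul, smul_add, smul_smul,
    smul_smul, add_smul]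
  rw [mul_neg_one]
  abel

section Powers

variable {B : Matrix (Fin 2) (Fin 2) (ZMod p)}

theorem matrix_pow_two (hB : B.det = 1) : B ^ 2 = B.trace • B + (-1 : ZMod p) • 1 := by
  rw [pow_succ_eq_of_pow_eq hB (n := 1) (x := 1) (y := 0) (by simp)]
  congr 2; ring

theorem matrix_pow_three (hB : B.det = 1) :
    B ^ 3 = (B.trace ^ 2 - 1) • B + (-B.trace) • 1 := by
  rw [pow_succ_eq_of_pow_eq hB (matrix_pow_two hB)]
  congr 2; ring

theorem matrix_pow_four (hB : B.det = 1) :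
    B ^ 4 = (B.trace ^ 3 - 2 * B.trace) • B + (1 - B.trace ^ 2) • 1 := by
  rw [pow_succ_eq_of_pow_eq hB (matrix_pow_three hB)]
  congr 2 <;> ring

theorem matrix_pow_five (hB : B.det = 1) :
    B ^ 5 = (B.trace ^ 4 - 3 * B.trace ^ 2 + 1) • B + (2 * B.trace - B.trace ^ 3) • 1 := by
  rw [pow_succ_eq_of_pow_eq hB (matrix_pow_four hB)]
  congr 2 <;> ring

theorem matrix_pow_six (hB : B.det = 1) :
    B ^ 6 = (B.trace ^ 5 - 4 * B.trace ^ 3 + 3 * B.trace) • B +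
      (3 * B.trace ^ 2 - B.trace ^ 4 - 1) • 1 := by
  rw [pow_succ_eq_of_pow_eq hB (matrix_pow_five hB)]
  congr 2 <;> ring

theorem pslMk_pow_eq_one {n : ℕ} {x y : ZMod p} (h : B ^ n = x • B + y • 1) (hx : x = 0)
    (hy : y = 1 ∨ y = -1) (hB : B.det = 1) : pslMk p B hB ^ n = 1 := by
  rw [pslMk_pow, pslMk_eq_one_iff, h, hx]
  rcases hy with rfl | rfl
  · left; simp
  · right; simp

/-- If a power of a nontrivial element is trivial, then the coefficient of the matrix in the
Cayley-Hamilton expansion of that power vanishes. -/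
theorem coeff_eq_zero_of_pslMk_pow_eq_one {n : ℕ} {x y : ZMod p} (h : B ^ n = x • B + y • 1)
    (hB : B.det = 1) (h1 : pslMk p B hB ≠ 1) (hn : pslMk p B hB ^ n = 1) : x = 0 := by
  by_contra hx
  apply h1
  rw [pslMk_pow, pslMk_eq_one_iff, h] at hn
  rw [pslMk_eq_one_iff]
  obtain ⟨a, b, c, d, rfl⟩ := exists_fin_two B
  have key : x * b = 0 ∧ x * c = 0 ∧ x * (a - d) = 0 := by
    rw [one_fin_two, neg_fin_two] at hn
    simp only [Matrix.smul_of, Matrix.smul_cons, Matrix.smul_empty, Matrix.of_add_of,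
      Matrix.empty_add_empty, smul_eq_mul, Matrix.add_cons, Matrix.head_cons,
      Matrix.tail_cons, fin_two_ext] at hn
    rcases hn with h | h
    · exact ⟨by linear_combination h.2.1, by linear_combination h.2.2.1,
        by linear_combination h.1 - h.2.2.2⟩
    · exact ⟨by linear_combination h.2.1, by linear_combination h.2.2.1,
        by linear_combination h.1 - h.2.2.2⟩
  simp only [mul_eq_zero, hx, false_or] at key
  obtain ⟨rfl, rfl, had⟩ := key
  obtain rfl : a = d := sub_eq_zero.1 had
  rw [Matrix.det_fin_two_of] at hB
  have : a * a = 1 := by linear_combination hB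
  rcases mul_self_eq_one_iff.1 this with rfl | rfl
  · left; rw [one_fin_two]
  · right; rw [one_fin_two, neg_fin_two, neg_zero]

end Powers

theorem exists_trace_eq_one {r : PSL(2, ZMod p)} (hr : r ^ 3 = 1) (hr1 : r ≠ 1) :
    ∃ A hA, A.trace = 1 ∧ r = pslMk p A hA := by
  obtain ⟨A, hA, rfl⟩ := exists_eq_pslMk r
  have h := coeff_eq_zero_of_pslMk_pow_eq_one (matrix_pow_three hA) hA hr1 hr
  have h' : A.trace * A.trace = 1 := by linear_combination h
  rcases mul_self_eq_one_iff.1 h' with h | h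
  · exact ⟨A, hA, h, rfl⟩
  · exact ⟨-A, det_neg_two hA, by rw [Matrix.trace_neg, h, neg_neg], pslMk_neg A hA⟩

theorem exists_involution_form {x : PSL(2, ZMod p)} (hx : x * x = 1) (hx1 : x ≠ 1) :
    ∃ (a b c : ZMod p) (h : _), a ^ 2 + b * c = -1 ∧ x = pslMk p !![a, b; c, -a] h := by
  obtain ⟨A, hA, rfl⟩ := exists_eq_pslMk x
  rw [← pow_two] at hx
  have h := coeff_eq_zero_of_pslMk_pow_eq_one (matrix_pow_two hA) hA hx1 hx
  obtain ⟨a, b, c, d, rfl⟩ := exists_fin_two A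
  obtain rfl : d = -a := by
    rw [Matrix.trace_fin_two] at h
    simp at h
    linear_combination h
  refine ⟨a, b, c, hA, ?_, rfl⟩
  rw [Matrix.det_fin_two_of] at hA
  linear_combination -hA

theorem exists_conjGL_eq_sStd (hp : 5 ≤ p) {x : PSL(2, ZMod p)} (hx : x * x = 1) (hx1 : x ≠ 1) :
    ∃ k, conjGL k x = sStd p := by
  obtain ⟨a, b, c, hdet, habc, rfl⟩ := exists_involution_form hx hx1
  have hs : (!![0, 1; -1, 0] : Matrix (Fin 2) (Fin 2) (ZMod p)).det = 1 := by
    rw [Matrix.det_fin_two_of]; ring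
  suffices ∃ k, conjGL k (sStd p) = pslMk p !![a, b; c, -a] hdet by
    obtain ⟨k, hk⟩ := this
    exact ⟨k⁻¹, by rw [← hk, map_inv, MulAut.inv_apply_self]⟩
  -- With `X` the matrix of `x` and `v = (e, f)`, the columns `v`, `-X v` form a basis unless `v` is
  -- an eigenvector. One of `(1,1)`, `(0,1)`, `(1,0)` always works.
  have key : ∀ e f : ZMod p, e * (c * e - a * f) - f * (a * e + b * f) ≠ 0 →
      ∃ k, conjGL k (sStd p) = pslMk p !![a, b; c, -a] hdet := by
    intro e f hef
    obtain ⟨k, -, hk⟩ := exists_conjGL_eq !![e, -(a * e + b * f); f, -(c * e - a * f)] _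
      !![a, b; c, -a] (by
        rw [Matrix.det_fin_two_of]
        intro h
        exact hef (by linear_combination -h)) hs hdet (by
        simp only [Matrix.mul_fin_two, fin_two_ext]
        refine ⟨?_, ?_, ?_, ?_⟩
        · ring
        · linear_combination e * habc
        · ring
        · linear_combination f * habc)
    exact ⟨k, hk⟩
  by_cases hc : c = 0
  · by_cases hb : b = 0
    · subst hb hc
      refine key 1 1 fun h => ?_
      have ha : a = 0 :=
        (mul_eq_zero.1 (by linear_combination -h : 2 * a = 0)).resolve_left (two_ne_zero_zmod hp)
      simp [ha] at habc
    · exact key 0 1 (by simpa using hb)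
  · exact key 1 0 (by simpa using hc)

theorem exists_conjGL_eq_rElt (hp : 5 ≤ p) {r x : PSL(2, ZMod p)} (hr : r ^ 3 = 1) (hr1 : r ≠ 1)
    (hx : x * x = 1) (hx1 : x ≠ 1) :
    ∃ (k : GL (Fin 2) (ZMod p)) (δ α β : ZMod p) (h : IsSolution p δ α β),
      conjGL k r = rElt p δ α β h ∧ conjGL k x = sStd p := by
  obtain ⟨k, hk⟩ := exists_conjGL_eq_sStd hp hx hx1
  obtain ⟨A, hA, htr, hAr⟩ := exists_trace_eq_one (r := conjGL k r)
    (by rw [← map_pow, hr, map_one]) (by simpa using hr1)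
  obtain ⟨a, b, c, d, rfl⟩ := exists_fin_two A
  have hd : d = 1 - a := by
    rw [Matrix.trace_fin_two] at htr
    simp at htr
    linear_combination htr
  subst hd
  refine ⟨k, c - b, a, b, ?_, ?_, hk⟩
  · rw [Matrix.det_fin_two_of] at hA
    unfold IsSolution
    linear_combination -hA
  · rw [hAr, rElt]
    simp only [add_sub_cancel]

theorem exists_conjGL_rElt_neg {δ α β : ZMod p} (h : IsSolution p δ α β) :
    ∃ (k : GL (Fin 2) (ZMod p)) (h' : IsSolution p (-δ) α (-β)),
      conjGL k (rElt p δ α β h) = rElt p (-δ) α (-β) h' ∧ conjGL k (sStd p) = sStd p := by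
  obtain ⟨k, hk⟩ := exists_GL_of_det_ne_zero (!![1, 0; 0, -1] : Matrix (Fin 2) (Fin 2) (ZMod p))
    (by simp)
  refine ⟨k, ?_, ?_, ?_⟩
  · unfold IsSolution at h ⊢
    linear_combination h
  · unfold rElt
    rw [conjGL_pslMk_eq_iff, hk]
    left
    simp only [Matrix.mul_fin_two, fin_two_ext]
    refine ⟨?_, ?_, ?_, ?_⟩ <;> ring
  · unfold sStd
    rw [conjGL_pslMk_eq_iff, hk]
    -- Conjugation by `diag(1, -1)` negates the matrix of `s`, which is harmless in `PSL(2,p)`.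
    right
    simp

/-- Up to conjugation by matrices centralizing `sStd`, the element `rElt` depends on `δ` only. -/
theorem exists_conjGL_rElt_eq {δ α β α' β' : ZMod p} (hδ : δ ^ 2 ≠ 3) (h : IsSolution p δ α β)
    (h' : IsSolution p δ α' β') :
    ∃ k : GL (Fin 2) (ZMod p),
      conjGL k (rElt p δ α β h) = rElt p δ α' β' h' ∧ conjGL k (sStd p) = sStd p := by
  have hs := h
  have hs' := h'
  unfold IsSolution at hs hs'
  -- The matrices with rows `(u, v)`, `(-v, u)` are those commuting with the matrix of `s`.
  have key : ∀ u v : ZMod p, u ^ 2 + v ^ 2 ≠ 0 →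
      (!![u, v; -v, u] : Matrix (Fin 2) (Fin 2) (ZMod p)) * !![α, β; β + δ, 1 - α] =
        !![α', β'; β' + δ, 1 - α'] * !![u, v; -v, u] →
      ∃ k : GL (Fin 2) (ZMod p),
        conjGL k (rElt p δ α β h) = rElt p δ α' β' h' ∧ conjGL k (sStd p) = sStd p := by
    intro u v huv hmat
    obtain ⟨k, hk⟩ := exists_GL_of_det_ne_zero
      (!![u, v; -v, u] : Matrix (Fin 2) (Fin 2) (ZMod p)) (by
        rw [Matrix.det_fin_two_of]
        intro h0
        exact huv (by linear_combination h0))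
    refine ⟨k, ?_, ?_⟩
    · unfold rElt
      rw [conjGL_pslMk_eq_iff, hk]
      exact Or.inl hmat
    · unfold sStd
      rw [conjGL_pslMk_eq_iff, hk]
      left
      simp
  -- Two intertwining matrices are available. Their determinants add up to `δ ^ 2 - 3`, so they are
  -- not both singular.
  by_cases h0 : (α + α' - 1) ^ 2 + (β - β') ^ 2 = 0
  · refine key (-(β + β' + δ)) (α - α') (fun h1 => hδ ?_) ?_
    · linear_combination h0 + h1 - 2 * hs - 2 * hs'
    · simp only [Matrix.mul_fin_two, fin_two_ext]
      refine ⟨?_, ?_, ?_, ?_⟩ <;>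
        first | ring1 | linear_combination hs - hs' | linear_combination hs' - hs
  · refine key (α + α' - 1) (β - β') h0 ?_
    simp only [Matrix.mul_fin_two, fin_two_ext]
    refine ⟨?_, ?_, ?_, ?_⟩ <;>
      first | ring1 | linear_combination hs - hs' | linear_combination hs' - hs

theorem rElt_mul_sStd {δ α β : ZMod p} (h : IsSolution p δ α β) :
    ∃ B hB, B.trace = δ ∧ rElt p δ α β h * sStd p = pslMk p B hB := by
  refine ⟨_, _, ?_, pslMk_mul _ _ _ _⟩
  simp [Matrix.trace_fin_two]

/-- The exceptional values of `δ` do not occur for generating pairs. -/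
theorem notMem_exceptionalSet (hp : 5 ≤ p) {r x : PSL(2, ZMod p)}
    (hrx : Subgroup.closure {r, x} = ⊤) (hr : r ^ 3 = 1) (hx : x * x = 1)
    {k : GL (Fin 2) (ZMod p)} {δ α β : ZMod p} (h : IsSolution p δ α β)
    (hkr : conjGL k r = rElt p δ α β h) (hkx : conjGL k x = sStd p) :
    δ ≠ 0 ∧ δ ^ 2 ≠ 3 ∧ δ ∉ exceptionalSet p := by
  have h2 := two_ne_zero_zmod hp
  obtain ⟨B, hB, hBδ, hprod⟩ := rElt_mul_sStd h
  subst hBδ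
  have hpow : ∀ n, pslMk p B hB ^ n = 1 → (r * x) ^ n = 1 := by
    intro n hn
    rw [← hprod, ← hkr, ← hkx, ← map_mul, ← map_pow] at hn
    exact (map_eq_one_iff _ (conjGL k).injective).1 hn
  have e0 : B.trace ≠ 0 := fun h0 => mul_pow_two_ne_one hp hrx hx
    (hpow 2 (pslMk_pow_eq_one (matrix_pow_two hB) h0 (Or.inr rfl) hB))
  have e1 : B.trace ≠ 1 := fun h1 => mul_pow_three_ne_one hp hrx hr hx
    (hpow 3 (pslMk_pow_eq_one (matrix_pow_three hB) (by rw [h1]; ring) (Or.inr (by rw [h1])) hB))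
  have e2 : B.trace ^ 2 ≠ 2 := fun h1 => mul_pow_four_ne_one hp hrx hr hx
    (hpow 4 (pslMk_pow_eq_one (matrix_pow_four hB) (by linear_combination B.trace * h1)
      (Or.inr (by linear_combination -h1)) hB))
  have e3 : B.trace ^ 2 ≠ 3 := fun h1 => mul_pow_six_ne_one hp hrx hr hx
    (hpow 6 (pslMk_pow_eq_one (matrix_pow_six hB)
      (by linear_combination (B.trace ^ 3 - B.trace) * h1)
      (Or.inr (by linear_combination -B.trace ^ 2 * h1)) hB))
  -- The congruence serves to exclude `p = 5`. The two quadratics are the factors of the coefficient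
  -- in `matrix_pow_five`.
  have e5 : (p % 5 = 1 ∨ p % 5 = 4) →
      ¬ (B.trace ^ 2 + B.trace - 1 = 0 ∨ B.trace ^ 2 - B.trace - 1 = 0) := by
    intro hmod h1
    have hp6 : p ≠ 6 := by
      rintro rfl
      exact absurd (Fact.out : Nat.Prime 6) (by norm_num)
    refine mul_pow_five_ne_one (by omega) hrx hr hx
      (hpow 5 (pslMk_pow_eq_one (matrix_pow_five hB) ?_ ?_ hB))
    · have : (B.trace ^ 2 + B.trace - 1) * (B.trace ^ 2 - B.trace - 1) = 0 := mul_eq_zero.2 h1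
      linear_combination this
    · rcases h1 with h1 | h1
      · left; linear_combination (1 - B.trace) * h1
      · right; linear_combination (-1 - B.trace) * h1
  refine ⟨e0, e3, ?_⟩
  rintro (h1 | ⟨-, y, hy, hl, -⟩ | ⟨-, y, hy, hl, -⟩ | ⟨hmod, y, hy, hl, -⟩)
  · exact e1 h1
  · rcases hl with hl | hl <;> exact e2 (by rw [hl]; linear_combination hy)
  · rcases hl with hl | hl <;> exact e3 (by rw [hl]; linear_combination hy)
  · rcases hl with hl | hl
    · refine e5 hmod (Or.inl ?_)
      rw [hl]; field_simp; linear_combination hy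
    · refine e5 hmod (Or.inr ?_)
      rw [Set.mem_singleton_iff.1 hl]; field_simp; linear_combination hy

/-- The subgroup of classes of upper triangular matrices. -/
def upperTriangular (p : ℕ) [Fact p.Prime] : Subgroup PSL(2, ZMod p) where
  carrier := {g | ∃ (a b d : ZMod p) (h : _), g = pslMk p !![a, b; 0, d] h}
  one_mem' := ⟨1, 0, 1, by simp, by
    rw [eq_comm, pslMk_eq_one_iff, one_fin_two]; exact Or.inl rfl⟩
  mul_mem' := by
    rintro _ _ ⟨a, b, d, h, rfl⟩ ⟨a', b', d', h', rfl⟩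
    rw [Matrix.det_fin_two_of] at h h'
    refine ⟨a * a', a * b' + b * d', d * d', ?_, ?_⟩
    · rw [Matrix.det_fin_two_of]
      linear_combination a' * d' * h + h'
    · rw [pslMk_mul, pslMk_eq_iff]
      left
      simp only [Matrix.mul_fin_two, fin_two_ext]
      simp
  inv_mem' := by
    rintro _ ⟨a, b, d, h, rfl⟩
    have h' := h
    rw [Matrix.det_fin_two_of] at h'
    refine ⟨d, -b, a, by rw [Matrix.det_fin_two_of]; linear_combination h', ?_⟩
    rw [inv_eq_iff_mul_eq_one, pslMk_mul, pslMk_eq_one_iff, one_fin_two]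
    left
    simp only [Matrix.mul_fin_two, fin_two_ext]
    refine ⟨?_, ?_, ?_, ?_⟩ <;> first | ring1 | linear_combination h'

theorem upperTriangular_ne_top : upperTriangular p ≠ ⊤ := by
  intro htop
  obtain ⟨a, b, d, h, hV⟩ : lowerUni p 1 ∈ upperTriangular p := htop ▸ Subgroup.mem_top _
  rw [lowerUni, pslMk_eq_iff, neg_fin_two, fin_two_ext, fin_two_ext] at hV
  rcases hV with hV | hV <;> simp at hV

theorem sElt_neg (c : (ZMod p)ˣ) : sElt p (-c) = sElt p c := by
  unfold sElt
  rw [pslMk_eq_iff, neg_fin_two]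
  right
  rw [fin_two_ext]
  exact ⟨neg_zero.symm, by rw [Units.val_neg, div_neg], Units.val_neg c, neg_zero.symm⟩

theorem exists_mulAut_eq_uElt_sElt (hp : 5 ≤ p) {r x : PSL(2, ZMod p)}
    (hrx : Subgroup.closure {r, x} = ⊤) (hr : r ^ p = 1) (hx : x * x = 1) :
    ∃ (φ : MulAut PSL(2, ZMod p)) (c : (ZMod p)ˣ), (c : ZMod p) ∈ halfSystem p ∧
      φ r = uElt p ∧ φ x = sElt p c := by
  obtain ⟨hr1, hx1⟩ := ne_one_of_closure_eq_top hp hrx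
  obtain ⟨k, hk⟩ := exists_conjGL_upperUni hp hr hr1
  have hkr : (conjGL k)⁻¹ r = upperUni p 1 := by rw [← hk, MulAut.inv_apply_self]
  obtain ⟨a, b, c, hdet, habc, hkx⟩ := exists_involution_form (x := (conjGL k)⁻¹ x)
    (by rw [← map_mul, hx, map_one]) (by simpa using hx1)
  -- Otherwise both generators lie, after conjugation, in the proper subgroup of upper triangular
  -- classes.
  have hc : c ≠ 0 := by
    rintro rfl
    apply upperTriangular_ne_top (p := p)
    have hle : Subgroup.closure {r, x} ≤
        (upperTriangular p).comap ((conjGL k)⁻¹ : MulAut PSL(2, ZMod p)).toMonoidHom := by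
      rw [Subgroup.closure_le]
      rintro y (rfl | rfl)
      · exact ⟨_, _, _, _, hkr⟩
      · exact ⟨_, _, _, _, hkx⟩
    rw [hrx, top_le_iff] at hle
    rw [eq_top_iff]
    intro y _
    have : conjGL k y ∈
        (upperTriangular p).comap ((conjGL k)⁻¹ : MulAut PSL(2, ZMod p)).toMonoidHom :=
      hle ▸ Subgroup.mem_top _
    have h2 : (conjGL k)⁻¹ (conjGL k y) ∈ upperTriangular p := this
    rwa [MulAut.inv_apply_self] at h2
  have hbc : b = -(1 + a ^ 2) / c := by field_simp; linear_combination habc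
  -- The shift by `a / c` clears the diagonal of the involution and centralizes `upperUni p 1`.
  obtain ⟨t, ht, htx⟩ := exists_conjGL_eq !![1, -(a / c); 0, 1] _ !![0, -(1 / c); c, 0] (by simp)
    hdet (by rw [Matrix.det_fin_two_of]; field_simp; ring) (by
      simp only [Matrix.mul_fin_two, fin_two_ext, hbc]
      refine ⟨?_, ?_, ?_, ?_⟩ <;> field_simp <;> ring)
  have hmain : ∀ c' : (ZMod p)ˣ, sElt p c' = sElt p (Units.mk0 c hc) →
      (conjGL t * (conjGL k)⁻¹) r = uElt p ∧ (conjGL t * (conjGL k)⁻¹) x = sElt p c' := by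
    intro c' hc'
    refine ⟨?_, ?_⟩
    · rw [MulAut.mul_apply, hkr, conjGL_upperUni ht]; rfl
    · rw [MulAut.mul_apply, hkx, htx, hc']; rfl
  rcases mem_halfSystem_or_neg_mem
    ((Fact.out : p.Prime).odd_of_ne_two (by omega)) hc with h | h
  · exact ⟨_, Units.mk0 c hc, h, hmain _ rfl⟩
  · exact ⟨_, -Units.mk0 c hc, by simpa using h, hmain _ (sElt_neg _)⟩

end NormalForms

theorem lemma4p2 (p : ℕ) [Fact p.Prime] (hp : 5 ≤ p) (M : CayleyMap (PSL(2, ZMod p)))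
    (hreg : M.IsRegular) (hbal : M.IsBalanced) :
    (M.valency = 3 →
      ∃ δ ∈ halfSystem p \ exceptionalSet p,
        (∃ α β : ZMod p, IsSolution p δ α β) ∧
        ∀ (α β : ZMod p) (h : IsSolution p δ α β),
          M.toMap.Isomorphic (mapP p δ α β h)) ∧
    (M.valency = p →
      ∃ c : (ZMod p)ˣ, (c : ZMod p) ∈ halfSystem p ∧
        M.toMap.Isomorphic (mapQ p c)) := by
  have hodd : Odd p := (Fact.out : p.Prime).odd_of_ne_two (by omega)
  constructor
  · intro hval
    obtain ⟨r, x, hr, hx, hrx, hiso⟩ := CayleyMap.exists_generators_of_isBalanced hp hreg hbal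
      (by rw [hval]; decide)
    rw [hval] at hr
    obtain ⟨hr1, hx1⟩ := ne_one_of_closure_eq_top hp hrx
    obtain ⟨k, δ, α, β, h, hkr, hkx⟩ := exists_conjGL_eq_rElt hp hr hr1 hx hx1
    -- Replacing `δ` by `-δ` if necessary puts it in `F'`; this needs `δ ≠ 0`.
    obtain ⟨k, δ, α, β, h, hkr, hkx, hδ⟩ : ∃ (k : GL (Fin 2) (ZMod p)) (δ α β : ZMod p)
        (h : IsSolution p δ α β), conjGL k r = rElt p δ α β h ∧ conjGL k x = sStd p ∧
          δ ∈ halfSystem p := by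
      have h0 := (notMem_exceptionalSet hp hrx hr hx h hkr hkx).1
      rcases mem_halfSystem_or_neg_mem hodd h0 with hδ | hδ
      · exact ⟨k, δ, α, β, h, hkr, hkx, hδ⟩
      · obtain ⟨t, h', htr, hts⟩ := exists_conjGL_rElt_neg h
        exact ⟨t * k, -δ, α, -β, h', by rw [map_mul, MulAut.mul_apply, hkr, htr],
          by rw [map_mul, MulAut.mul_apply, hkx, hts], hδ⟩
    obtain ⟨-, h3, hexc⟩ := notMem_exceptionalSet hp hrx hr hx h hkr hkx
    refine ⟨δ, ⟨hδ, hexc⟩, ⟨α, β, h⟩, fun α' β' h' => ?_⟩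
    obtain ⟨t, htr, hts⟩ := exists_conjGL_rElt_eq h3 h h'
    exact hiso (conjGL (t * k)) _ _ _ _ (by rw [map_mul, MulAut.mul_apply, hkr, htr])
      (by rw [map_mul, MulAut.mul_apply, hkx, hts])
  · intro hval
    obtain ⟨r, x, hr, hx, hrx, hiso⟩ := CayleyMap.exists_generators_of_isBalanced hp hreg hbal
      (by rw [hval]; exact hodd)
    rw [hval] at hr
    obtain ⟨φ, c, hc, hφr, hφx⟩ := exists_mulAut_eq_uElt_sElt hp hrx hr hx
    exact ⟨c, hc, hiso φ _ _ _ _ hφr hφx⟩
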